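/- **Theorem (Zeroes of the rate functions).** Let $d\ge 1$ be an integer, $\beta>0$ and $a>b>0$. The pressure of the ideal Bose gas is $$p_0(\beta,s)=\frac{1}{\beta(4\pi\beta)^{d/2}}\sum_{k=1}^\infty\frac{e^{\beta s k}}{k^{1+d/2}}\in(0,\infty],$$ and $p_0'(\beta,s)$ denotes its derivative in $s$. Its free energy is $f_0(\beta,x)=\sup_{s\in\mathbb R}\{sx-p_0(\beta,s)\}$, and its critical density is $\varrho_{\rm c}=(4\pi\beta)^{-d/2}\zeta(d/2)$ if $d\ge 3$ and $\varrho_{\rm c}=+\infty$ if $d\in\{1,2\}$. For $\kappa\in[0,\infty]$ let $\mathbb K(\kappa)=[0,\infty)\times(\{0\}\cup[\kappa,\infty))$, where $[\infty,\infty)=\emptyset$. For $\mu\in\mathbb R$ let $$I^{(\kappa)}(x,y)=f_0(\beta,x)-\mu(x+y)+\tfrac a2(x+y)^2-\tfrac b2y^2+p^{(\kappa)}\quad\text{for }(x,y)\in\mathbb K(\kappa),$$ and $I^{(\kappa)}=+\infty$ on $\mathbb R^2\setminus\mathbb K(\kappa)$, where $$p^{(\kappa)}=\sup_{(x,y)\in\mathbb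 K(\kappa)}\Big\{\mu(x+y)-\tfrac a2(x+y)^2+\tfrac b2y^2-f_0(\beta,x)\Big\}.$$ Let $\mathscr M^{(\kappa)}(\mu)$ be the set of zeroes of $I^{(\kappa)}$. For $x>0$ let $s_\beta(x)=0$ if $x\ge\varrho_{\rm c}$, and otherwise let $s_\beta(x)$ be the unique $s<0$ with $p_0'(\beta,s)=x$. Put $\mu_{\rm c}=a\varrho_{\rm c}$ and $\mu_{\rm t}=\inf_{s<0}\{a\,p_0'(\beta,s)-\frac{a-b}{b}s\}$. - For $\mu\in\mathbb R$ let $\tilde x_1(\mu)$ be the unique solution $x>0$ of $s_\beta(x)=\mu-ax$. - For $\mu\ge\mu_{\rm t}$ let $\tilde x_2(\mu)$ be the minimal solution $x>0$ of $s_\beta(x)=-\frac{b}{a-b}(\mu-ax)$, and put $\tilde y_2(\mu)=\frac{\mu-a\tilde x_2(\mu)}{a-b}$. - For $\kappa\in(0,\infty)$ let $\tilde x_3(\mu)=\tilde x_1(\mu-a\kappa)$ and $\mu_{\rm r}=\mu_{\rm r}(\kappa)=\inf\{s\ge\mu_{\rm t}:\tilde x_2(s)\le\frac1a(s-\kappa(a-b))\}$.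 These objects are well defined: the solutions exist, with the uniqueness and minimality stated, and the set defining $\mu_{\rm r}(\kappa)$ is non-empty. Moreover the following holds. 1. ($\kappa=0$) There is $\mu^*\in\mathbb R$ with $\mu_{\rm t}\le\mu^*\le\mu_{\rm c}$ such that $$\mathscr M^{(0)}(\mu)=\begin{cases}\{(\tilde x_1(\mu),0)\}&\text{for }\mu<\mu^*,\\ \{(\tilde x_1(\mu),0),(\tilde x_2(\mu),\tilde y_2(\mu))\}&\text{for }\mu=\mu^*,\\ \{(\tilde x_2(\mu),\tilde y_2(\mu))\}&\text{for }\mu>\mu^*.\end{cases}$$ If $\mu^*=\mu_{\rm c}$, then there is always a unique zero: it is $(\tilde x_1(\mu),0)$ for $\mu\le\mu_{\rm c}$ and $(\tilde x_2(\mu),\tilde y_2(\mu))$ for $\mu>\mu_{\rm c}$, and $\tilde x_1(\mu^*)=\tilde x_2(\mu^*)$. 2. ($\kappa\in(0,\infty)$) With the same $\mu^*$, for every $\kappa\in(0,\infty)$ there is $\mu^*_\kappa\in\mathbb R$ such that the following holds. - If $\mu_{\rm r}\le\mu^*$, then $\mu^*_\kappa=\mu^*$ and $$\mathscr M^{(\kappa)}(\mu)=\begin{cases}\{(\tilde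 x_1(\mu),0)\}&\text{for }\mu<\mu^*_\kappa,\\ \{(\tilde x_1(\mu),0),(\tilde x_2(\mu),\tilde y_2(\mu))\}&\text{for }\mu=\mu^*_\kappa,\\ \{(\tilde x_2(\mu),\tilde y_2(\mu))\}&\text{for }\mu>\mu^*_\kappa.\end{cases}$$ - If $\mu_{\rm r}>\mu^*$, then $\mu^*_\kappa\in(\mu^*,\mu_{\rm r})$ and $$\mathscr M^{(\kappa)}(\mu)=\begin{cases}\{(\tilde x_1(\mu),0)\}&\text{for }\mu<\mu^*_\kappa,\\ \{(\tilde x_1(\mu),0),(\tilde x_3(\mu),\kappa)\}&\text{for }\mu=\mu^*_\kappa,\\ \{(\tilde x_3(\mu),\kappa)\}&\text{for }\mu\in(\mu^*_\kappa,\mu_{\rm r}],\\ \{(\tilde x_2(\mu),\tilde y_2(\mu))\}&\text{for }\mu\ge\mu_{\rm r}.\end{cases}$$ 3. ($\kappa=\infty$) $\mathscr M^{(\infty)}(\mu)=\{(\tilde x_1(\mu),0)\}$ for all $\mu\in\mathbb R$. -/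

import Mathlib

open scoped ENNReal

noncomputable section

namespace HYL

/-- The cycle weight `q_k = (4πβ)^{-d/2} k^{-(1+d/2)}`, used for `k ≥ 1`. -/
def cycleWeight (d : ℕ) (β : ℝ) (k : ℕ) : ℝ :=
  1 / ((4 * Real.pi * β) ^ ((d : ℝ) / 2) * (k : ℝ) ^ (1 + (d : ℝ) / 2))

/-- Thermodynamic pressure of the ideal Bose gas,
`p₀(β,α) = β⁻¹ ∑_{k ≥ 1} q_k e^{βαk}`; it is finite for `α ≤ 0` and `+∞` for `α > 0`. -/
def idealPressure (d : ℕ) (β α : ℝ) : ℝ≥0∞ :=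
  ENNReal.ofReal (1 / β) *
    ∑' k : ℕ, ENNReal.ofReal (cycleWeight d β (k + 1) * Real.exp (β * α * ((k : ℝ) + 1)))

/-- The partial derivative of `p₀(β,s)` in `s`, used for `s < 0`. -/
def idealPressureDeriv (d : ℕ) (β s : ℝ) : ℝ :=
  deriv (fun t : ℝ => (idealPressure d β t).toReal) s

/-- Free energy of the ideal Bose gas, the Legendre-Fenchel transform
`f₀(β,x) = sup_{α ∈ ℝ} (α x - p₀(β,α))`. -/
def freeEnergy (d : ℕ) (β x : ℝ) : EReal :=
  ⨆ α : ℝ, ((α * x : ℝ) : EReal) - (idealPressure d β α : EReal)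

/-- Critical density of the ideal Bose gas:
`(4πβ)^{-d/2} ζ(d/2)` for `d ≥ 3`, and `+∞` for `d = 1, 2`. -/
def criticalDensity (d : ℕ) (β : ℝ) : EReal :=
  if 3 ≤ d then
    ((1 / (4 * Real.pi * β) ^ ((d : ℝ) / 2) *
      ∑' k : ℕ, 1 / ((k : ℝ) + 1) ^ ((d : ℝ) / 2) : ℝ) : EReal)
  else ⊤

/-- `𝕂(κ) = ℝ₊ × ({0} ∪ [κ,∞))` for `κ ∈ [0,∞]`. -/
def stateSpace (κ : ℝ≥0∞) : Set (ℝ × ℝ) :=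
  {p | 0 ≤ p.1 ∧ (p.2 = 0 ∨ (0 ≤ p.2 ∧ κ ≤ ENNReal.ofReal p.2))}

/-- The pressure
`p^{(κ)} = sup_{(x,y) ∈ 𝕂(κ)} {μ(x+y) - (a/2)(x+y)² + (b/2)y² - f₀(β,x)}`. -/
def pressure (d : ℕ) (β a b : ℝ) (κ : ℝ≥0∞) (μ : ℝ) : EReal :=
  ⨆ p ∈ stateSpace κ,
    ((μ * (p.1 + p.2) - a / 2 * (p.1 + p.2) ^ 2 + b / 2 * p.2 ^ 2 : ℝ) : EReal)
      - freeEnergy d β p.1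

open Classical in
/-- The rate function `I^{(κ)}`. -/
def rateFunction (d : ℕ) (β a b : ℝ) (κ : ℝ≥0∞) (μ : ℝ) (p : ℝ × ℝ) : EReal :=
  if p ∈ stateSpace κ then
    freeEnergy d β p.1
      + ((-μ * (p.1 + p.2) + a / 2 * (p.1 + p.2) ^ 2 - b / 2 * p.2 ^ 2 : ℝ) : EReal)
      + pressure d β a b κ μ
  else ⊤

/-- The set `𝓜^{(κ)}(μ)` of zeroes of the rate function. -/
def zeroSet (d : ℕ) (β a b : ℝ) (κ : ℝ≥0∞) (μ : ℝ) : Set (ℝ × ℝ) :=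
  {p | rateFunction d β a b κ μ p = 0}

open Classical in
/-- `s_β(x)`, for `x > 0`: zero for `x ≥ ϱ_c`, otherwise the solution `s < 0` of
`p₀'(β,s) = x`. -/
def sBeta (d : ℕ) (β x : ℝ) : ℝ :=
  if criticalDensity d β ≤ (x : EReal) then 0
  else Classical.epsilon fun s : ℝ => s < 0 ∧ idealPressureDeriv d β s = x

/-- `μ_t = inf_{s < 0} {a p₀'(β,s) - ((a-b)/b) s}`. -/
def muT (d : ℕ) (β a b : ℝ) : ℝ :=
  sInf ((fun s : ℝ => a * idealPressureDeriv d β s - (a - b) / b * s) '' Set.Iio 0)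

/-- `μ_c = a ϱ_c`. -/
def muC (d : ℕ) (β a : ℝ) : EReal :=
  (a : EReal) * criticalDensity d β

/-- `x̃₁(μ)`: the solution `x > 0` of `s_β(x) = μ - a x`. -/
def xOne (d : ℕ) (β a μ : ℝ) : ℝ :=
  Classical.epsilon fun x : ℝ => 0 < x ∧ sBeta d β x = μ - a * x

/-- The set of solutions `x > 0` of `s_β(x) = -(b/(a-b)) (μ - a x)`. -/
def xTwoSolutions (d : ℕ) (β a b μ : ℝ) : Set ℝ :=
  {x | 0 < x ∧ sBeta d β x = -(b / (a - b)) * (μ - a * x)}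

/-- `x̃₂(μ)`, for `μ ≥ μ_t`: the minimal solution of `s_β(x) = -(b/(a-b)) (μ - a x)`. -/
def xTwo (d : ℕ) (β a b μ : ℝ) : ℝ :=
  sInf (xTwoSolutions d β a b μ)

/-- `x̃₃(μ) = x̃₁(μ - a κ)`. -/
def xThree (d : ℕ) (β a κ μ : ℝ) : ℝ :=
  xOne d β a (μ - a * κ)

/-- The set `{s ≥ μ_t : x̃₂(s) ≤ (s - κ(a-b))/a}`. -/
def muRSet (d : ℕ) (β a b κ : ℝ) : Set ℝ :=
  {s | muT d β a b ≤ s ∧ xTwo d β a b s ≤ 1 / a * (s - κ * (a - b))}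

/-- `μ_r(κ) = inf {s ≥ μ_t : x̃₂(s) ≤ (s - κ(a-b))/a}`. -/
def muR (d : ℕ) (β a b κ : ℝ) : ℝ :=
  sInf (muRSet d β a b κ)

/-- The point `(x̃₁(μ), 0)`. -/
def pointOne (d : ℕ) (β a μ : ℝ) : ℝ × ℝ :=
  (xOne d β a μ, 0)

/-- The point `(x̃₂(μ), (μ - a x̃₂(μ))/(a-b))`. -/
def pointTwo (d : ℕ) (β a b μ : ℝ) : ℝ × ℝ :=
  (xTwo d β a b μ, (μ - a * xTwo d β a b μ) / (a - b))

/-- The point `(x̃₃(μ), κ)`. -/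
def pointThree (d : ℕ) (β a κ μ : ℝ) : ℝ × ℝ :=
  (xThree d β a κ μ, κ)

end HYL

end

open scoped ENNReal

noncomputable section

namespace HYL

open Filter Topology Set

/-! The supremum `pressure` is minus the minimum of the energy, i.e. of the free energy of `x` plus
the quadratic interaction. Zeroes of the rate function are therefore exactly the minimisers of the
energy on the state space (`zeroSet_eq`). They exist because the energy is lower semicontinuous and,
as `a > b`, grows quadratically in `x + y`.

By Legendre duality `s_β` plays the role of the derivative of the free energy. For fixed `y` the
energy is strictly convex in `x`, which forces `s_β(x) = μ - a(x+y)`, so `y = 0` gives `x̃₁(μ)` and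
`y = κ` gives `x̃₃(μ)`. For fixed `x` the energy is a convex parabola in `y`, so a minimiser with `y
> κ` also has `s_β(x) = -b y`. Eliminating `y` leaves the equation of `x̃₂`, namely `levelPotential
d β a b x = μ`. It may have several solutions; since `p₀'` is strictly convex, a trapezoid
inequality shows that the smallest has strictly less energy than any other solution up to `ϱ_c`
(`energy_pointTwo_lt`).

The phases are ordered in `μ`: once a minimiser has `y > 0`, so do all minimisers at larger `μ`
(`not_isMinimizer_of_lt`). The proof exchanges condensate between two minimisers and contradicts
strict convexity of the free energy. Hence there is a single threshold, and limits of minimisers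
from either side show that both phases coexist there. For finite `κ`, the set defining `μ_r` is the
half-line from `μ_r` on. There the unconstrained condensate is at least `κ`, so the problem reduces
to `κ = 0`; below `μ_r` a positive condensate must equal `κ`. -/

/-- The real value `p₀(β,t)` of the ideal pressure, for `t ≤ 0`. -/
def pressureReal (d : ℕ) (β t : ℝ) : ℝ :=
  ∑' k : ℕ, 1 / β * (cycleWeight d β (k + 1) * Real.exp (β * t * ((k : ℝ) + 1)))

/-- The series of the density `p₀'(β,t)`. -/
def density (d : ℕ) (β t : ℝ) : ℝ :=
  ∑' k : ℕ, cycleWeight d β (k + 1) * ((k : ℝ) + 1) * Real.exp (β * t * ((k : ℝ) + 1))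

/-! ### Pressure and density as exponential series. -/

section Series

variable {d : ℕ} {β : ℝ}

lemma cycleWeight_pos (hβ : 0 < β) (k : ℕ) : 0 < cycleWeight d β (k + 1) := by
  unfold cycleWeight
  have := Real.pi_pos
  positivity

lemma cycleWeight_mul (hβ : 0 < β) (k : ℕ) :
    cycleWeight d β (k + 1) * ((k : ℝ) + 1) =
      1 / (4 * Real.pi * β) ^ ((d : ℝ) / 2) * (1 / ((k : ℝ) + 1) ^ ((d : ℝ) / 2)) := by
  have hk : (0 : ℝ) < (k : ℝ) + 1 := by positivity
  have hA : 0 < (4 * Real.pi * β) ^ ((d : ℝ) / 2) := by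
    have := Real.pi_pos
    positivity
  have hr : 0 < ((k : ℝ) + 1) ^ ((d : ℝ) / 2) := by positivity
  unfold cycleWeight
  push_cast
  rw [Real.rpow_add hk, Real.rpow_one]
  field_simp

lemma summable_one_div_succ_rpow {r : ℝ} :
    Summable (fun k : ℕ => 1 / ((k : ℝ) + 1) ^ r) ↔ 1 < r := by
  rw [← Real.summable_one_div_nat_rpow,
    ← summable_nat_add_iff 1 (f := fun n : ℕ => 1 / (n : ℝ) ^ r)]
  push_cast
  rfl

lemma summable_cycleWeight (hd : 1 ≤ d) :
    Summable (fun k : ℕ => cycleWeight d β (k + 1)) := by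
  have hr : (1 : ℝ) < 1 + (d : ℝ) / 2 := by
    have : (1 : ℝ) ≤ d := by exact_mod_cast hd
    linarith
  have := (summable_one_div_succ_rpow.2 hr).mul_left (1 / (4 * Real.pi * β) ^ ((d : ℝ) / 2))
  refine this.congr fun k => ?_
  unfold cycleWeight
  push_cast
  rw [one_div_mul_one_div]

lemma exp_le_one_of_nonpos (hβ : 0 < β) {t : ℝ} (ht : t ≤ 0) (k : ℕ) :
    Real.exp (β * t * ((k : ℝ) + 1)) ≤ 1 := by
  rw [Real.exp_le_one_iff]
  exact mul_nonpos_of_nonpos_of_nonneg (mul_nonpos_of_nonneg_of_nonpos hβ.le ht) (by positivity)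

lemma summable_pressure (hd : 1 ≤ d) (hβ : 0 < β) {t : ℝ} (ht : t ≤ 0) :
    Summable (fun k : ℕ =>
      1 / β * (cycleWeight d β (k + 1) * Real.exp (β * t * ((k : ℝ) + 1)))) := by
  refine Summable.mul_left _ (Summable.of_nonneg_of_le (fun k => ?_) (fun k => ?_)
    (summable_cycleWeight (β := β) hd))
  · exact mul_nonneg (cycleWeight_pos hβ k).le (Real.exp_pos _).le
  · exact mul_le_of_le_one_right (cycleWeight_pos hβ k).le (exp_le_one_of_nonpos hβ ht k)

lemma density_term_pos (hβ : 0 < β) (t : ℝ) (k : ℕ) :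
    0 < cycleWeight d β (k + 1) * ((k : ℝ) + 1) * Real.exp (β * t * ((k : ℝ) + 1)) := by
  have := cycleWeight_pos (d := d) hβ k
  positivity

lemma summable_density (hβ : 0 < β) {t : ℝ} (ht : t < 0) :
    Summable (fun k : ℕ =>
      cycleWeight d β (k + 1) * ((k : ℝ) + 1) * Real.exp (β * t * ((k : ℝ) + 1))) := by
  have hA : 0 < (4 * Real.pi * β) ^ ((d : ℝ) / 2) := by
    have := Real.pi_pos
    positivity
  have hgeo : Summable (fun k : ℕ => Real.exp (β * t) ^ k) :=
    summable_geometric_of_lt_one (Real.exp_pos _).le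
      (Real.exp_lt_one_iff.2 (mul_neg_of_pos_of_neg hβ ht))
  refine Summable.of_nonneg_of_le (fun k => (density_term_pos hβ t k).le) (fun k => ?_)
    (hgeo.mul_left (1 / (4 * Real.pi * β) ^ ((d : ℝ) / 2)))
  rw [cycleWeight_mul hβ]
  have h1 : 1 / ((k : ℝ) + 1) ^ ((d : ℝ) / 2) ≤ 1 := by
    rw [div_le_one (by positivity)]
    exact Real.one_le_rpow (by linarith [(Nat.cast_nonneg k : (0 : ℝ) ≤ k)]) (by positivity)
  have h2 : Real.exp (β * t * ((k : ℝ) + 1)) ≤ Real.exp (β * t) ^ k := by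
    rw [← Real.exp_nat_mul, Real.exp_le_exp]
    nlinarith [mul_neg_of_pos_of_neg hβ ht]
  have h3 : 0 ≤ 1 / ((k : ℝ) + 1) ^ ((d : ℝ) / 2) := by positivity
  have h4 := (Real.exp_pos (β * t * ((k : ℝ) + 1))).le
  rw [mul_assoc]
  refine mul_le_mul_of_nonneg_left ?_ (by positivity)
  calc _ ≤ 1 * Real.exp (β * t * ((k : ℝ) + 1)) := by gcongr
    _ ≤ _ := by rw [one_mul]; exact h2

/-- For `d ≤ 2` the series diverges and both sides are the default value `0`; the value at `0` is
meaningful only for `d ≥ 3`. -/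
lemma density_zero (hβ : 0 < β) :
    density d β 0 = 1 / (4 * Real.pi * β) ^ ((d : ℝ) / 2) *
      ∑' k : ℕ, 1 / ((k : ℝ) + 1) ^ ((d : ℝ) / 2) := by
  unfold density
  rw [← tsum_mul_left]
  refine tsum_congr fun k => ?_
  rw [cycleWeight_mul hβ]
  simp

lemma summable_density_zero_iff (hβ : 0 < β) :
    Summable (fun k : ℕ =>
      cycleWeight d β (k + 1) * ((k : ℝ) + 1) * Real.exp (β * 0 * ((k : ℝ) + 1))) ↔ 3 ≤ d := by
  have hA : 0 < (4 * Real.pi * β) ^ ((d : ℝ) / 2) := by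
    have := Real.pi_pos
    positivity
  simp_rw [cycleWeight_mul hβ]
  simp only [mul_zero, zero_mul, Real.exp_zero, mul_one]
  rw [summable_mul_left_iff (by positivity), summable_one_div_succ_rpow, lt_div_iff₀ (by norm_num)]
  norm_num
  exact ⟨fun h => by exact_mod_cast h, fun h => by exact_mod_cast h⟩

lemma density_pos (hβ : 0 < β) {t : ℝ} (ht : t < 0) : 0 < density d β t :=
  (summable_density hβ ht).tsum_pos (fun k => (density_term_pos hβ t k).le) 0
    (density_term_pos hβ t 0)

lemma density_lt_density (hβ : 0 < β) {u v : ℝ} (huv : u < v) (hv : v < 0 ∨ v = 0 ∧ 3 ≤ d) :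
    density d β u < density d β v := by
  have hsv : Summable (fun k : ℕ =>
      cycleWeight d β (k + 1) * ((k : ℝ) + 1) * Real.exp (β * v * ((k : ℝ) + 1))) := by
    rcases hv with hv | ⟨rfl, h3⟩
    · exact summable_density hβ hv
    · exact (summable_density_zero_iff hβ).2 h3
  have hu : u < 0 := by rcases hv with hv | ⟨rfl, -⟩ <;> linarith
  have key : ∀ k : ℕ,
      cycleWeight d β (k + 1) * ((k : ℝ) + 1) * Real.exp (β * u * ((k : ℝ) + 1)) <
        cycleWeight d β (k + 1) * ((k : ℝ) + 1) * Real.exp (β * v * ((k : ℝ) + 1)) := by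
    intro k
    have := cycleWeight_pos (d := d) hβ k
    gcongr
  exact (summable_density hβ hu).tsum_lt_tsum (fun k => (key k).le) (key 0) hsv

lemma toReal_idealPressure (hd : 1 ≤ d) (hβ : 0 < β) {t : ℝ} (ht : t ≤ 0) :
    idealPressure d β t = ENNReal.ofReal (pressureReal d β t) := by
  have hs := summable_pressure hd hβ ht
  unfold idealPressure pressureReal
  rw [← ENNReal.tsum_mul_left, ENNReal.ofReal_tsum_of_nonneg _ hs]
  · refine tsum_congr fun k => ?_
    rw [ENNReal.ofReal_mul (p := 1 / β) (by positivity)]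
  · intro k
    have := cycleWeight_pos (d := d) hβ k
    positivity

lemma pressureReal_nonneg (hβ : 0 < β) (t : ℝ) : 0 ≤ pressureReal d β t := by
  refine tsum_nonneg fun k => ?_
  have := cycleWeight_pos (d := d) hβ k
  positivity

lemma idealPressure_eq_top (hβ : 0 < β) {t : ℝ} (ht : 0 < t) : idealPressure d β t = ⊤ := by
  unfold idealPressure
  rw [ENNReal.mul_eq_top]
  left
  refine ⟨by simpa using hβ, ?_⟩
  by_contra hne
  have h0 := ENNReal.tendsto_atTop_zero_of_tsum_ne_top hne
  have hbt : 0 < β * t := mul_pos hβ ht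
  have hA : 0 < (4 * Real.pi * β) ^ ((d : ℝ) / 2) := by
    have := Real.pi_pos
    positivity
  have h1 : Tendsto (fun k : ℕ => Real.exp (β * t * ((k : ℝ) + 1)) /
      ((k : ℝ) + 1) ^ (1 + (d : ℝ) / 2)) atTop atTop :=
    (tendsto_exp_mul_div_rpow_atTop (1 + (d : ℝ) / 2) (β * t) hbt).comp
      (tendsto_atTop_add_const_right _ 1 tendsto_natCast_atTop_atTop)
  have h2 := h1.const_mul_atTop (r := 1 / (4 * Real.pi * β) ^ ((d : ℝ) / 2)) (by positivity)
  have h3 : Tendsto (fun k : ℕ => ENNReal.ofReal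
      (cycleWeight d β (k + 1) * Real.exp (β * t * ((k : ℝ) + 1)))) atTop (𝓝 ⊤) := by
    refine (ENNReal.tendsto_ofReal_atTop.comp h2).congr fun k => ?_
    simp only [Function.comp]
    congr 1
    unfold cycleWeight
    push_cast
    field_simp
  exact ENNReal.top_ne_zero (tendsto_nhds_unique h3 h0)

lemma hasDerivAt_pressureReal (hd : 1 ≤ d) (hβ : 0 < β) {t : ℝ} (ht : t < 0) :
    HasDerivAt (pressureReal d β) (density d β t) t := by
  have ht2 : t / 2 < 0 := by linarith
  have hmem : t ∈ Iio (t / 2) := by rw [mem_Iio]; linarith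
  unfold density
  refine hasDerivAt_tsum_of_isPreconnected
    (g := fun (k : ℕ) (t : ℝ) =>
      1 / β * (cycleWeight d β (k + 1) * Real.exp (β * t * ((k : ℝ) + 1))))
    (g' := fun (k : ℕ) (t : ℝ) =>
      cycleWeight d β (k + 1) * ((k : ℝ) + 1) * Real.exp (β * t * ((k : ℝ) + 1)))
    (summable_density (d := d) hβ ht2)
    isOpen_Iio isPreconnected_Iio ?_ ?_ hmem (summable_pressure hd hβ ht.le) hmem
  · intro k y _
    have h : HasDerivAt (fun y : ℝ => β * y * ((k : ℝ) + 1)) (β * ((k : ℝ) + 1)) y := by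
      simpa using ((hasDerivAt_id y).const_mul β).mul_const ((k : ℝ) + 1)
    refine ((h.exp.const_mul (cycleWeight d β (k + 1))).const_mul (1 / β)).congr_deriv ?_
    field_simp
  · intro k y hy
    rw [Real.norm_of_nonneg (density_term_pos hβ y k).le]
    have := cycleWeight_pos (d := d) hβ k
    have hy' : y ≤ t / 2 := le_of_lt hy
    gcongr

lemma idealPressureDeriv_eq (hd : 1 ≤ d) (hβ : 0 < β) {t : ℝ} (ht : t < 0) :
    idealPressureDeriv d β t = density d β t := by
  unfold idealPressureDeriv
  refine HasDerivAt.deriv ((hasDerivAt_pressureReal hd hβ ht).congr_of_eventuallyEq ?_)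
  filter_upwards [Iio_mem_nhds ht] with y hy
  rw [toReal_idealPressure hd hβ (le_of_lt hy), ENNReal.toReal_ofReal (pressureReal_nonneg hβ y)]

lemma continuousOn_density (hβ : 0 < β) : ContinuousOn (density d β) (Iio 0) := by
  intro t ht
  have ht' : t < 0 := ht
  have ht2 : t / 2 < 0 := by linarith
  have h : ContinuousOn (density d β) (Iic (t / 2)) := by
    refine continuousOn_tsum (fun k => by fun_prop) (summable_density (d := d) hβ ht2) ?_
    intro k y hy
    rw [Real.norm_of_nonneg (density_term_pos hβ y k).le]
    have := cycleWeight_pos (d := d) hβ k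
    have hy' : y ≤ t / 2 := hy
    gcongr
  exact (h.continuousAt (Iic_mem_nhds (by linarith))).continuousWithinAt

lemma exists_lt_density (hβ : 0 < β) {x : ℝ}
    (hx : (x : EReal) < criticalDensity d β) : ∃ t < 0, x < density d β t := by
  -- A finite partial sum at `t = 0` already exceeds `x`, whether the full series converges or not.
  -- Partial sums are continuous in `t`, so this persists for some `t < 0`.
  have hn : ∃ n : ℕ, x < ∑ k ∈ Finset.range n,
      cycleWeight d β (k + 1) * ((k : ℝ) + 1) * Real.exp (β * 0 * ((k : ℝ) + 1)) := by
    by_cases h3 : 3 ≤ d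
    · unfold criticalDensity at hx
      rw [if_pos h3, ← density_zero hβ, EReal.coe_lt_coe_iff] at hx
      have := ((summable_density_zero_iff (d := d) hβ).2 h3).hasSum.tendsto_sum_nat
      exact (this.eventually (lt_mem_nhds hx)).exists
    · have hns := mt (summable_density_zero_iff (d := d) hβ).1 h3
      have := (not_summable_iff_tendsto_nat_atTop_of_nonneg
        (fun k => (density_term_pos (d := d) hβ 0 k).le)).1 hns
      exact (this.eventually_gt_atTop x).exists
  obtain ⟨n, hn⟩ := hn
  have hc : Continuous (fun t : ℝ => ∑ k ∈ Finset.range n,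
      cycleWeight d β (k + 1) * ((k : ℝ) + 1) * Real.exp (β * t * ((k : ℝ) + 1))) := by
    fun_prop
  have hev := (hc.continuousAt (x := 0)).eventually (lt_mem_nhds hn)
  have hev' : ∀ᶠ t in 𝓝[<] (0 : ℝ), t < 0 ∧ x < ∑ k ∈ Finset.range n,
      cycleWeight d β (k + 1) * ((k : ℝ) + 1) * Real.exp (β * t * ((k : ℝ) + 1)) :=
    (eventually_mem_nhdsWithin).and (hev.filter_mono nhdsWithin_le_nhds)
  obtain ⟨t, ht, hxt⟩ := hev'.exists
  exact ⟨t, ht, hxt.trans_le ((summable_density hβ ht).sum_le_tsum _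
    fun k _ => (density_term_pos hβ t k).le)⟩

lemma exists_density_lt (hβ : 0 < β) {x : ℝ} (hx : 0 < x) : ∃ t < 0, density d β t < x := by
  have hbound : ∀ t ≤ (-1 : ℝ), density d β t ≤ density d β (-1) * Real.exp (β * (t + 1)) := by
    intro t ht
    unfold density
    rw [← tsum_mul_right]
    refine (summable_density hβ (by linarith)).tsum_le_tsum (fun k => ?_)
      ((summable_density hβ (by linarith)).mul_right _)
    have := cycleWeight_pos (d := d) hβ k
    rw [mul_assoc _ (Real.exp _), ← Real.exp_add]
    gcongr
    have hk : (0 : ℝ) ≤ k := Nat.cast_nonneg k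
    nlinarith [mul_nonneg (mul_nonneg hβ.le (by linarith : 0 ≤ -1 - t)) hk]
  have hlim : Tendsto (fun t : ℝ => density d β (-1) * Real.exp (β * (t + 1))) atBot (𝓝 0) := by
    have h : Tendsto (fun t : ℝ => β * (t + 1)) atBot atBot :=
      (tendsto_atBot_add_const_right _ 1 tendsto_id).const_mul_atBot hβ
    simpa using (Real.tendsto_exp_atBot.comp h).const_mul (density d β (-1))
  obtain ⟨t, ht, htx⟩ :=
    ((eventually_le_atBot (-1 : ℝ)).and (hlim.eventually (gt_mem_nhds hx))).exists
  exact ⟨t, by linarith, (hbound t ht).trans_lt htx⟩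

lemma exists_density_eq (hβ : 0 < β) {x : ℝ} (hx : 0 < x)
    (hxc : (x : EReal) < criticalDensity d β) : ∃ t < 0, density d β t = x := by
  obtain ⟨u, hu, hux⟩ := exists_density_lt (d := d) hβ hx
  obtain ⟨v, hv, hvx⟩ := exists_lt_density hβ hxc
  obtain ⟨t, ht, htx⟩ := isPreconnected_Iio.intermediate_value (mem_Iio.2 hu) (mem_Iio.2 hv)
    (continuousOn_density hβ) ⟨hux.le, hvx.le⟩
  exact ⟨t, ht, htx⟩

lemma density_lt_criticalDensity (hβ : 0 < β) {t : ℝ} (ht : t < 0) :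
    (density d β t : EReal) < criticalDensity d β := by
  unfold criticalDensity
  split_ifs with h3
  · rw [← density_zero hβ, EReal.coe_lt_coe_iff]
    exact density_lt_density hβ ht (Or.inr ⟨rfl, h3⟩)
  · exact EReal.coe_lt_top _

lemma summable_density_of (hβ : 0 < β) {v : ℝ} (hv : v < 0 ∨ v = 0 ∧ 3 ≤ d) :
    Summable (fun k : ℕ =>
      cycleWeight d β (k + 1) * ((k : ℝ) + 1) * Real.exp (β * v * ((k : ℝ) + 1))) := by
  rcases hv with hv | ⟨rfl, h3⟩
  · exact summable_density hβ hv
  · exact (summable_density_zero_iff hβ).2 h3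

/-- The tangent inequality for the convex function `p₀`. -/
lemma pressureReal_tangent (hd : 1 ≤ d) (hβ : 0 < β) {t v : ℝ} (ht : t < 0 ∨ t = 0 ∧ 3 ≤ d)
    (hv : v ≤ 0) :
    pressureReal d β t + density d β t * (v - t) ≤ pressureReal d β v := by
  have ht0 : t ≤ 0 := by rcases ht with ht | ⟨rfl, -⟩ <;> linarith
  unfold density
  rw [← tsum_mul_right]
  unfold pressureReal
  rw [← (summable_pressure hd hβ ht0).tsum_add ((summable_density_of hβ ht).mul_right _)]
  refine ((summable_pressure hd hβ ht0).add ((summable_density_of hβ ht).mul_right _)).tsum_le_tsum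
    (fun k => ?_) (summable_pressure hd hβ hv)
  have hw := cycleWeight_pos (d := d) hβ k
  have h1 : Real.exp (β * v * ((k : ℝ) + 1)) =
      Real.exp (β * t * ((k : ℝ) + 1)) * Real.exp (β * (v - t) * ((k : ℝ) + 1)) := by
    rw [← Real.exp_add]; ring_nf
  have h2 := Real.add_one_le_exp (β * (v - t) * ((k : ℝ) + 1))
  have h3 := Real.exp_pos (β * t * ((k : ℝ) + 1))
  rw [h1]
  calc _ = 1 / β * (cycleWeight d β (k + 1) * (Real.exp (β * t * ((k : ℝ) + 1)) *
        (β * (v - t) * ((k : ℝ) + 1) + 1))) := by field_simp; ring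
    _ ≤ _ := by gcongr

/-- The trapezoid rule strictly overestimates the integral of `exp` over `[0, z]`. The difference
has derivative `(1 + y e^y - e^y)/2`, positive because `e^{-y} > 1 - y`. -/
lemma exp_sub_one_lt {z : ℝ} (hz : 0 < z) :
    Real.exp z - 1 < z * (1 + Real.exp z) / 2 := by
  have hder : ∀ y : ℝ, HasDerivAt (fun y => y * (1 + Real.exp y) / 2 - Real.exp y)
      ((1 + Real.exp y + y * Real.exp y) / 2 - Real.exp y) y := by
    intro y
    refine ((((hasDerivAt_id y).mul ((Real.hasDerivAt_exp y).const_add 1)).div_const 2).sub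
      (Real.hasDerivAt_exp y)).congr_deriv ?_
    simp
  have hmono : StrictMonoOn (fun y : ℝ => y * (1 + Real.exp y) / 2 - Real.exp y) (Ici 0) := by
    refine strictMonoOn_of_deriv_pos (convex_Ici 0) (by fun_prop) fun y hy => ?_
    rw [interior_Ici] at hy
    rw [(hder y).deriv]
    have hy0 : y ≠ 0 := (ne_of_gt hy)
    have h1 := Real.add_one_lt_exp (neg_ne_zero.2 hy0)
    have h2 : Real.exp (-y) * Real.exp y = 1 := by rw [← Real.exp_add]; simp
    nlinarith [mul_lt_mul_of_pos_right h1 (Real.exp_pos y)]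
  have := hmono (mem_Ici.2 le_rfl) (mem_Ici.2 hz.le) hz
  simp at this
  linarith

/-- The trapezoid inequality for the strictly convex function `p₀'`. -/
lemma pressureReal_trapezoid (hd : 1 ≤ d) (hβ : 0 < β) {u v : ℝ} (huv : u < v)
    (hv : v < 0 ∨ v = 0 ∧ 3 ≤ d) :
    pressureReal d β v - pressureReal d β u <
      (density d β u + density d β v) * ((v - u) / 2) := by
  have hv0 : v ≤ 0 := by rcases hv with hv | ⟨rfl, -⟩ <;> linarith
  have hu : u < 0 := by linarith
  have hsp := (summable_pressure hd hβ hv0).sub (summable_pressure hd hβ hu.le)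
  have hsd := ((summable_density (d := d) hβ hu).add (summable_density_of hβ hv)).mul_right
    ((v - u) / 2)
  unfold density
  rw [← (summable_density hβ hu).tsum_add (summable_density_of hβ hv), ← tsum_mul_right]
  unfold pressureReal
  rw [← (summable_pressure hd hβ hv0).tsum_sub (summable_pressure hd hβ hu.le)]
  -- Each summand is a pure exponential, so the claim reduces termwise to `exp_sub_one_lt` at `z = β
  -- (v - u) (k + 1)`.
  have key : ∀ k : ℕ, 1 / β * (cycleWeight d β (k + 1) * Real.exp (β * v * ((k : ℝ) + 1))) -
      1 / β * (cycleWeight d β (k + 1) * Real.exp (β * u * ((k : ℝ) + 1))) <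
      (cycleWeight d β (k + 1) * ((k : ℝ) + 1) * Real.exp (β * u * ((k : ℝ) + 1)) +
        cycleWeight d β (k + 1) * ((k : ℝ) + 1) * Real.exp (β * v * ((k : ℝ) + 1))) *
        ((v - u) / 2) := by
    intro k
    have hw := cycleWeight_pos (d := d) hβ k
    have hz : 0 < β * (v - u) * ((k : ℝ) + 1) := by
      have : 0 < v - u := by linarith
      positivity
    have h1 : Real.exp (β * v * ((k : ℝ) + 1)) =
        Real.exp (β * u * ((k : ℝ) + 1)) * Real.exp (β * (v - u) * ((k : ℝ) + 1)) := by
      rw [← Real.exp_add]; ring_nf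
    have h2 := exp_sub_one_lt hz
    have h3 := Real.exp_pos (β * u * ((k : ℝ) + 1))
    rw [h1]
    calc _ = 1 / β * (cycleWeight d β (k + 1) * (Real.exp (β * u * ((k : ℝ) + 1)) *
          (Real.exp (β * (v - u) * ((k : ℝ) + 1)) - 1))) := by ring
      _ < 1 / β * (cycleWeight d β (k + 1) * (Real.exp (β * u * ((k : ℝ) + 1)) *
          (β * (v - u) * ((k : ℝ) + 1) *
            (1 + Real.exp (β * (v - u) * ((k : ℝ) + 1))) / 2))) := by gcongr
      _ = _ := by field_simp
  exact hsp.tsum_lt_tsum (fun k => (key k).le) (key 0) hsd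

end Series

/-! ### The function `s_β` and the free energy by Legendre duality. -/

/-- The real value of the free energy, for `x ≥ 0`. -/
def freeEnergyReal (d : ℕ) (β x : ℝ) : ℝ := (freeEnergy d β x).toReal

section FreeEnergy

variable {d : ℕ} {β : ℝ}

lemma existsUnique_idealPressureDeriv_eq (hd : 1 ≤ d) (hβ : 0 < β) {x : ℝ} (hx : 0 < x)
    (hxc : (x : EReal) < criticalDensity d β) :
    ∃! s : ℝ, s < 0 ∧ idealPressureDeriv d β s = x := by
  obtain ⟨t, ht, htx⟩ := exists_density_eq hβ hx hxc
  refine ⟨t, ⟨ht, by rw [idealPressureDeriv_eq hd hβ ht, htx]⟩, ?_⟩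
  rintro u ⟨hu, hux⟩
  rw [idealPressureDeriv_eq hd hβ hu, ← htx] at hux
  rcases lt_trichotomy u t with h | h | h
  · exact absurd hux (density_lt_density hβ h (Or.inl ht)).ne
  · exact h
  · exact absurd hux (density_lt_density hβ h (Or.inl hu)).ne'

lemma sBeta_spec (hd : 1 ≤ d) (hβ : 0 < β) {x : ℝ} (hx : 0 < x)
    (hxc : (x : EReal) < criticalDensity d β) :
    sBeta d β x < 0 ∧ density d β (sBeta d β x) = x := by
  have h := Classical.epsilon_spec (existsUnique_idealPressureDeriv_eq hd hβ hx hxc).exists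
  have hs : sBeta d β x =
      Classical.epsilon fun s : ℝ => s < 0 ∧ idealPressureDeriv d β s = x := by
    unfold sBeta
    rw [if_neg (not_le.2 hxc)]
  rw [← hs] at h
  exact ⟨h.1, by rw [← idealPressureDeriv_eq hd hβ h.1, h.2]⟩

lemma sBeta_eq_zero {x : ℝ} (hx : criticalDensity d β ≤ (x : EReal)) : sBeta d β x = 0 := by
  unfold sBeta
  rw [if_pos hx]

lemma sBeta_neg_iff (hd : 1 ≤ d) (hβ : 0 < β) {x : ℝ} (hx : 0 < x) :
    sBeta d β x < 0 ↔ (x : EReal) < criticalDensity d β := by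
  refine ⟨fun h => ?_, fun h => (sBeta_spec hd hβ hx h).1⟩
  by_contra hc
  rw [sBeta_eq_zero (not_lt.1 hc)] at h
  exact lt_irrefl _ h

lemma sBeta_nonpos (hd : 1 ≤ d) (hβ : 0 < β) {x : ℝ} (hx : 0 < x) : sBeta d β x ≤ 0 := by
  rcases lt_or_ge (x : EReal) (criticalDensity d β) with h | h
  · exact (sBeta_spec hd hβ hx h).1.le
  · exact (sBeta_eq_zero h).le

/-- The order form of `s_β` being the inverse of the density. It stays valid for `x ≥ ϱ_c`, where
both sides are false, and so spares case distinctions later. -/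
lemma sBeta_le_iff (hd : 1 ≤ d) (hβ : 0 < β) {x t : ℝ} (hx : 0 < x) (ht : t < 0) :
    sBeta d β x ≤ t ↔ x ≤ density d β t := by
  rcases lt_or_ge (x : EReal) (criticalDensity d β) with h | h
  · obtain ⟨h1, h2⟩ := sBeta_spec hd hβ hx h
    constructor
    · intro hle
      rw [← h2]
      rcases hle.eq_or_lt with he | hl
      · rw [he]
      · exact (density_lt_density hβ hl (Or.inl ht)).le
    · intro hle
      by_contra hc
      have := density_lt_density (d := d) hβ (not_le.1 hc) (Or.inl h1)
      linarith
  · rw [sBeta_eq_zero h]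
    have h1 := (density_lt_criticalDensity (d := d) hβ ht).trans_le h
    rw [EReal.coe_lt_coe_iff] at h1
    constructor <;> intro <;> linarith

lemma sBeta_density (hd : 1 ≤ d) (hβ : 0 < β) {t : ℝ} (ht : t < 0) :
    sBeta d β (density d β t) = t := by
  obtain ⟨h1, h2⟩ := sBeta_spec hd hβ (density_pos hβ ht) (density_lt_criticalDensity hβ ht)
  refine le_antisymm ((sBeta_le_iff hd hβ (density_pos hβ ht) ht).2 le_rfl) ?_
  by_contra hc
  exact absurd h2 (density_lt_density hβ (not_le.1 hc) (Or.inl ht)).ne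

lemma sBeta_mono (hd : 1 ≤ d) (hβ : 0 < β) {x x' : ℝ} (hx : 0 < x) (hxx' : x ≤ x') :
    sBeta d β x ≤ sBeta d β x' := by
  rcases (sBeta_nonpos hd hβ (hx.trans_le hxx')).eq_or_lt with h | h
  · rw [h]
    exact sBeta_nonpos hd hβ hx
  · exact (sBeta_le_iff hd hβ hx h).2
      (hxx'.trans ((sBeta_le_iff hd hβ (hx.trans_le hxx') h).1 le_rfl))

lemma sBeta_strictMono (hd : 1 ≤ d) (hβ : 0 < β) {x x' : ℝ} (hx : 0 < x) (hxx' : x < x')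
    (hs : sBeta d β x < 0) : sBeta d β x < sBeta d β x' := by
  by_contra hc
  have h1 := (sBeta_le_iff hd hβ (hx.trans hxx') hs).1 (not_lt.1 hc)
  rw [(sBeta_spec hd hβ hx ((sBeta_neg_iff hd hβ hx).1 hs)).2] at h1
  linarith

lemma exists_sBeta_eq (hd : 1 ≤ d) (hβ : 0 < β) {t : ℝ} (ht : t < 0) :
    ∃ x, 0 < x ∧ sBeta d β x = t :=
  ⟨_, density_pos hβ ht, sBeta_density hd hβ ht⟩

lemma exists_forall_sBeta_le (hd : 1 ≤ d) (hβ : 0 < β) (M : ℝ) :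
    ∃ δ > 0, ∀ x, 0 < x → x ≤ δ → sBeta d β x ≤ M := by
  have hm : min M (-1) < 0 := (min_le_right _ _).trans_lt (by norm_num)
  exact ⟨_, density_pos (d := d) hβ hm, fun x hx hxd =>
    ((sBeta_le_iff hd hβ hx hm).2 hxd).trans (min_le_left _ _)⟩

/-- A monotone function that takes every negative value and is never positive cannot jump, not even
at `ϱ_c`. -/
lemma continuousAt_sBeta (hd : 1 ≤ d) (hβ : 0 < β) {x : ℝ} (hx : 0 < x) :
    ContinuousAt (sBeta d β) x := by
  refine tendsto_order.2 ⟨fun c hc => ?_, fun c hc => ?_⟩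
  · obtain ⟨t, hct, hts⟩ := exists_between hc
    have ht : t < 0 := hts.trans_le (sBeta_nonpos hd hβ hx)
    obtain ⟨z, hz, hzt⟩ := exists_sBeta_eq hd hβ ht
    have hzx : z < x := by
      by_contra h
      have := sBeta_mono hd hβ hx (not_lt.1 h)
      linarith
    filter_upwards [lt_mem_nhds hzx] with y hy
    have := sBeta_mono hd hβ hz hy.le
    linarith
  · rcases lt_or_ge 0 c with h0 | h0
    · filter_upwards [lt_mem_nhds hx] with y hy
      exact (sBeta_nonpos hd hβ hy).trans_lt h0
    · obtain ⟨t, hst, htc⟩ := exists_between hc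
      have ht : t < 0 := by linarith
      obtain ⟨z, hz, hzt⟩ := exists_sBeta_eq hd hβ ht
      have hxz : x < z := by
        by_contra h
        have := sBeta_mono hd hβ hz (not_lt.1 h)
        linarith
      filter_upwards [lt_mem_nhds hx, gt_mem_nhds hxz] with y hy hyz
      have := sBeta_mono hd hβ hy hyz.le
      linarith

lemma continuousOn_sBeta (hd : 1 ≤ d) (hβ : 0 < β) : ContinuousOn (sBeta d β) (Ioi 0) :=
  fun _ hx => (continuousAt_sBeta hd hβ hx).continuousWithinAt

lemma freeEnergy_term (hd : 1 ≤ d) (hβ : 0 < β) {α : ℝ} (hα : α ≤ 0) (x : ℝ) :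
    ((α * x : ℝ) : EReal) - (idealPressure d β α : EReal) =
      ((α * x - pressureReal d β α : ℝ) : EReal) := by
  rw [toReal_idealPressure hd hβ hα, EReal.coe_ennreal_ofReal,
    max_eq_left (pressureReal_nonneg hβ α), EReal.coe_sub]

lemma freeEnergy_le (hd : 1 ≤ d) (hβ : 0 < β) {x : ℝ} {c : EReal}
    (h : ∀ α ≤ 0, ((α * x - pressureReal d β α : ℝ) : EReal) ≤ c) : freeEnergy d β x ≤ c := by
  refine iSup_le fun α => ?_
  rcases le_or_gt α 0 with hα | hα
  · rw [freeEnergy_term hd hβ hα]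
    exact h α hα
  · rw [idealPressure_eq_top hβ hα]
    simp

lemma le_freeEnergy (hd : 1 ≤ d) (hβ : 0 < β) (x : ℝ) {α : ℝ} (hα : α ≤ 0) :
    ((α * x - pressureReal d β α : ℝ) : EReal) ≤ freeEnergy d β x := by
  rw [← freeEnergy_term hd hβ hα]
  exact le_iSup (fun α : ℝ => ((α * x : ℝ) : EReal) - (idealPressure d β α : EReal)) α

lemma coe_freeEnergyReal (hd : 1 ≤ d) (hβ : 0 < β) {x : ℝ} (hx : 0 ≤ x) :
    (freeEnergyReal d β x : EReal) = freeEnergy d β x := by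
  refine EReal.coe_toReal (fun h => ?_) (fun h => ?_)
  · have h1 : freeEnergy d β x ≤ ((0 : ℝ) : EReal) := freeEnergy_le hd hβ fun α hα => by
      rw [EReal.coe_le_coe_iff]
      have := pressureReal_nonneg (d := d) hβ α
      nlinarith
    rw [h] at h1
    exact absurd h1 (not_le.2 (EReal.coe_lt_top _))
  · have h1 := le_freeEnergy hd hβ x le_rfl
    rw [h] at h1
    exact absurd h1 (not_le.2 (EReal.bot_lt_coe _))

lemma freeEnergyReal_le (hd : 1 ≤ d) (hβ : 0 < β) {x c : ℝ} (hx : 0 ≤ x)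
    (h : ∀ α ≤ 0, α * x - pressureReal d β α ≤ c) : freeEnergyReal d β x ≤ c := by
  rw [← EReal.coe_le_coe_iff, coe_freeEnergyReal hd hβ hx]
  exact freeEnergy_le hd hβ fun α hα => EReal.coe_le_coe_iff.2 (h α hα)

lemma le_freeEnergyReal (hd : 1 ≤ d) (hβ : 0 < β) {x α : ℝ} (hx : 0 ≤ x) (hα : α ≤ 0) :
    α * x - pressureReal d β α ≤ freeEnergyReal d β x := by
  rw [← EReal.coe_le_coe_iff, coe_freeEnergyReal hd hβ hx]
  exact le_freeEnergy hd hβ x hα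

lemma freeEnergyReal_nonpos (hd : 1 ≤ d) (hβ : 0 < β) {x : ℝ} (hx : 0 ≤ x) :
    freeEnergyReal d β x ≤ 0 := by
  refine freeEnergyReal_le hd hβ hx fun α hα => ?_
  have := pressureReal_nonneg (d := d) hβ α
  nlinarith

lemma neg_pressureReal_le (hd : 1 ≤ d) (hβ : 0 < β) {x : ℝ} (hx : 0 ≤ x) :
    -pressureReal d β 0 ≤ freeEnergyReal d β x := by
  simpa using le_freeEnergyReal hd hβ hx le_rfl

lemma lowerSemicontinuousOn_freeEnergyReal (hd : 1 ≤ d) (hβ : 0 < β) :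
    LowerSemicontinuousOn (freeEnergyReal d β) (Ici 0) := by
  intro x hx y hy
  have hα : ∃ α ≤ 0, y < α * x - pressureReal d β α := by
    by_contra! h
    exact absurd (freeEnergyReal_le hd hβ hx h) (not_le.2 hy)
  obtain ⟨α, hα, hyα⟩ := hα
  have hc : Continuous fun z : ℝ => α * z - pressureReal d β α := by fun_prop
  filter_upwards [nhdsWithin_le_nhds (hc.continuousAt.eventually (lt_mem_nhds hyα)),
    self_mem_nhdsWithin] with z hz hz0
  exact hz.trans_le (le_freeEnergyReal hd hβ hz0 hα)

lemma three_le_of_criticalDensity_le {x : ℝ} (hx : criticalDensity d β ≤ (x : EReal)) :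
    3 ≤ d := by
  by_contra h
  unfold criticalDensity at hx
  rw [if_neg h] at hx
  exact absurd hx (not_le.2 (EReal.coe_lt_top _))

lemma criticalDensity_eq (hβ : 0 < β) (h3 : 3 ≤ d) :
    criticalDensity d β = (density d β 0 : EReal) := by
  unfold criticalDensity
  rw [if_pos h3, density_zero hβ]

/-- The tangent to `p₀` at `s_β(x)` shows that the supremum is attained there. Beyond `ϱ_c` the
tangent at `0` has slope `ϱ_c ≤ x`, which suffices because only `α ≤ 0` compete. -/
lemma freeEnergyReal_eq (hd : 1 ≤ d) (hβ : 0 < β) {x : ℝ} (hx : 0 < x) :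
    freeEnergyReal d β x = sBeta d β x * x - pressureReal d β (sBeta d β x) := by
  refine le_antisymm (freeEnergyReal_le hd hβ hx.le fun α hα => ?_)
    (le_freeEnergyReal hd hβ hx.le (sBeta_nonpos hd hβ hx))
  rcases lt_or_ge (x : EReal) (criticalDensity d β) with h | h
  · obtain ⟨h1, h2⟩ := sBeta_spec hd hβ hx h
    have := pressureReal_tangent hd hβ (Or.inl h1) hα
    rw [h2] at this
    linarith
  · have h3 := three_le_of_criticalDensity_le h
    have := pressureReal_tangent hd hβ (Or.inr ⟨rfl, h3⟩) hα
    rw [sBeta_eq_zero h]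
    rw [criticalDensity_eq hβ h3, EReal.coe_le_coe_iff] at h
    nlinarith

lemma freeEnergyReal_subgradient (hd : 1 ≤ d) (hβ : 0 < β) {x x' : ℝ} (hx : 0 < x)
    (hx' : 0 ≤ x') :
    freeEnergyReal d β x + sBeta d β x * (x' - x) ≤ freeEnergyReal d β x' := by
  have := le_freeEnergyReal hd hβ hx' (sBeta_nonpos hd hβ hx)
  rw [freeEnergyReal_eq hd hβ hx]
  linarith

lemma freeEnergyReal_strict_subgradient (hd : 1 ≤ d) (hβ : 0 < β) {x w : ℝ} (hx : 0 < x)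
    (hxw : x < w) (hs : sBeta d β x < 0) :
    freeEnergyReal d β w + sBeta d β w * (x - w) < freeEnergyReal d β x := by
  have hsw := sBeta_strictMono hd hβ hx hxw hs
  have hw := hx.trans hxw
  -- Going from `w` to `x` through a point `m` whose slope `t` lies strictly below the slope at `w`
  -- makes the inequality strict.
  obtain ⟨t, ht1, ht2⟩ := exists_between hsw
  obtain ⟨m, hm, hmt⟩ := exists_sBeta_eq hd hβ (ht2.trans_le (sBeta_nonpos hd hβ hw))
  have hxm : x < m := by
    by_contra h
    have := sBeta_mono hd hβ hm (not_lt.1 h)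
    linarith
  have h1 := freeEnergyReal_subgradient hd hβ hm hx.le
  have h2 := freeEnergyReal_subgradient hd hβ hw hm.le
  rw [hmt] at h1
  nlinarith

/-- The Legendre dual of `pressureReal_trapezoid`: convexity of `p₀'` is concavity of its inverse
`s_β`. The bound `x ≤ ϱ_c` is what makes the density at `s_β(x)` equal to `x`. -/
lemma freeEnergyReal_trapezoid (hd : 1 ≤ d) (hβ : 0 < β) {x' x : ℝ} (hx' : 0 < x')
    (hxx' : x' < x) (hx : (x : EReal) ≤ criticalDensity d β) :
    (sBeta d β x + sBeta d β x') * ((x - x') / 2) <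
      freeEnergyReal d β x - freeEnergyReal d β x' := by
  have hx0 := hx'.trans hxx'
  have h' : (x' : EReal) < criticalDensity d β := (EReal.coe_lt_coe_iff.2 hxx').trans_le hx
  obtain ⟨h1, h2⟩ := sBeta_spec hd hβ hx' h'
  have hss := sBeta_strictMono hd hβ hx' hxx' h1
  have h3 : (sBeta d β x < 0 ∨ sBeta d β x = 0 ∧ 3 ≤ d) ∧ density d β (sBeta d β x) = x := by
    rcases hx.lt_or_eq with h | h
    · obtain ⟨h4, h5⟩ := sBeta_spec hd hβ hx0 h
      exact ⟨Or.inl h4, h5⟩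
    · have h4 := three_le_of_criticalDensity_le h.ge
      rw [sBeta_eq_zero h.ge]
      refine ⟨Or.inr ⟨rfl, h4⟩, ?_⟩
      rw [criticalDensity_eq hβ h4] at h
      exact (EReal.coe_injective h).symm
  have := pressureReal_trapezoid hd hβ hss h3.1
  rw [h2, h3.2] at this
  rw [freeEnergyReal_eq hd hβ hx0, freeEnergyReal_eq hd hβ hx']
  linarith

end FreeEnergy

/-! ### Solutions of the stationarity equations, and the numbers `μ_t`, `μ_r`. -/

/-- The chemical potential `a x - ((a-b)/b) s_β(x)` for which `x` solves the equation of `x̃₂`. -/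
def levelPotential (d : ℕ) (β a b x : ℝ) : ℝ := a * x - (a - b) / b * sBeta d β x

section Solutions

variable {d : ℕ} {β a b : ℝ}

lemma existsUnique_xOne (hd : 1 ≤ d) (hβ : 0 < β) (ha : 0 < a) (μ : ℝ) :
    ∃! x : ℝ, 0 < x ∧ sBeta d β x = μ - a * x := by
  obtain ⟨δ, hδ, hs⟩ := exists_forall_sBeta_le hd hβ (μ - a)
  set l := min δ 1
  have hl : 0 < l := lt_min hδ one_pos
  have hl1 : l ≤ 1 := min_le_right _ _
  set u := max 1 ((μ - sBeta d β 1) / a)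
  have hu : 1 ≤ u := le_max_left _ _
  have hc : ContinuousOn (fun x => sBeta d β x + a * x) (Icc l u) :=
    ((continuousOn_sBeta hd hβ).mono fun x hx => hl.trans_le hx.1).add (by fun_prop)
  have h1 : sBeta d β l + a * l ≤ μ := by
    have := hs l hl (min_le_left _ _)
    nlinarith
  have h2 : μ ≤ sBeta d β u + a * u := by
    have h3 := sBeta_mono hd hβ one_pos hu
    have h4 : (μ - sBeta d β 1) / a ≤ u := le_max_right _ _
    rw [div_le_iff₀ ha] at h4
    linarith
  obtain ⟨x, hx, hxμ⟩ := intermediate_value_Icc (hl1.trans hu) hc ⟨h1, h2⟩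
  have hx0 : 0 < x := hl.trans_le hx.1
  simp only at hxμ
  refine ⟨x, ⟨hx0, by linarith⟩, ?_⟩
  rintro y ⟨hy0, hy⟩
  rcases lt_trichotomy y x with h | h | h
  · have := sBeta_mono hd hβ hy0 h.le
    nlinarith
  · exact h
  · have := sBeta_mono hd hβ hx0 h.le
    nlinarith

lemma xOne_spec (hd : 1 ≤ d) (hβ : 0 < β) (ha : 0 < a) (μ : ℝ) :
    0 < xOne d β a μ ∧ sBeta d β (xOne d β a μ) = μ - a * xOne d β a μ :=
  Classical.epsilon_spec (existsUnique_xOne hd hβ ha μ).exists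

lemma eq_xOne (hd : 1 ≤ d) (hβ : 0 < β) (ha : 0 < a) {μ x : ℝ} (hx : 0 < x)
    (h : sBeta d β x = μ - a * x) : x = xOne d β a μ :=
  (existsUnique_xOne hd hβ ha μ).unique ⟨hx, h⟩ (xOne_spec hd hβ ha μ)

lemma mem_xTwoSolutions_iff (hb : 0 < b) (hab : b < a) {μ x : ℝ} :
    x ∈ xTwoSolutions d β a b μ ↔ 0 < x ∧ levelPotential d β a b x = μ := by
  have h : 0 < a - b := sub_pos.2 hab
  unfold xTwoSolutions levelPotential
  rw [mem_ofPred_eq]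
  refine and_congr_right fun _ => ⟨fun hs => ?_, fun hs => ?_⟩
  · rw [hs]
    field_simp
    ring
  · rw [← hs]
    field_simp
    ring

lemma exists_forall_le_levelPotential (hd : 1 ≤ d) (hβ : 0 < β) (hb : 0 < b) (hab : b < a)
    (M : ℝ) : ∃ δ > 0, ∀ x, 0 < x → x ≤ δ → M ≤ levelPotential d β a b x := by
  have h : 0 < (a - b) / b := div_pos (sub_pos.2 hab) hb
  obtain ⟨δ, hδ, hs⟩ := exists_forall_sBeta_le hd hβ (-M / ((a - b) / b))
  refine ⟨δ, hδ, fun x hx hxδ => ?_⟩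
  have h1 := hs x hx hxδ
  rw [le_div_iff₀ h] at h1
  have h2 : 0 < a * x := mul_pos (hb.trans hab) hx
  unfold levelPotential
  linarith

lemma continuousOn_levelPotential (hd : 1 ≤ d) (hβ : 0 < β) :
    ContinuousOn (levelPotential d β a b) (Ioi 0) := by
  have := continuousOn_sBeta (d := d) hd hβ
  unfold levelPotential
  fun_prop

lemma exists_levelPotential_min (hd : 1 ≤ d) (hβ : 0 < β) (hb : 0 < b) (hab : b < a) {c : ℝ}
    (hc : 0 < c) : ∃ z, 0 < z ∧ z ≤ c ∧
      ∀ x, 0 < x → x ≤ c → levelPotential d β a b z ≤ levelPotential d β a b x := by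
  obtain ⟨δ, hδ, hs⟩ := exists_forall_le_levelPotential hd hβ hb hab (levelPotential d β a b c)
  have hl : 0 < min δ c := lt_min hδ hc
  obtain ⟨z, hz, hmin⟩ := (isCompact_Icc (a := min δ c) (b := c)).exists_isMinOn
    (nonempty_Icc.2 (min_le_right _ _))
    ((continuousOn_levelPotential (a := a) (b := b) hd hβ).mono fun x hx => hl.trans_le hx.1)
  refine ⟨z, hl.trans_le hz.1, hz.2, fun x hx hxc => ?_⟩
  rcases le_or_gt (min δ c) x with h | h
  · exact hmin ⟨h, hxc⟩
  · exact (hmin (right_mem_Icc.2 (min_le_right _ _))).trans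
      (hs x hx (h.le.trans (min_le_left _ _)))

lemma exists_levelPotential_eq (hd : 1 ≤ d) (hβ : 0 < β) (hb : 0 < b) (hab : b < a) {z μ : ℝ}
    (hz : 0 < z) (hμ : levelPotential d β a b z ≤ μ) :
    ∃ x, 0 < x ∧ x ≤ z ∧ levelPotential d β a b x = μ := by
  obtain ⟨δ, hδ, hs⟩ := exists_forall_le_levelPotential hd hβ hb hab μ
  have hl : 0 < min δ z := lt_min hδ hz
  obtain ⟨x, hx, hxμ⟩ := intermediate_value_Icc' (min_le_right δ z)
    ((continuousOn_levelPotential (a := a) (b := b) hd hβ).mono fun x hx => hl.trans_le hx.1)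
    ⟨hμ, hs _ hl (min_le_left _ _)⟩
  exact ⟨x, hl.trans_le hx.1, hx.2, hxμ⟩

lemma exists_levelPotential_global_min (hd : 1 ≤ d) (hβ : 0 < β) (hb : 0 < b) (hab : b < a) :
    ∃ z, 0 < z ∧ ∀ x, 0 < x → levelPotential d β a b z ≤ levelPotential d β a b x := by
  have ha := hb.trans hab
  have h : 0 < (a - b) / b := div_pos (sub_pos.2 hab) hb
  obtain ⟨z, hz, -, hmin⟩ := exists_levelPotential_min hd hβ hb hab
    (c := max 1 (levelPotential d β a b 1 / a)) (by positivity)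
  refine ⟨z, hz, fun x hx => ?_⟩
  rcases le_or_gt x (max 1 (levelPotential d β a b 1 / a)) with hxc | hxc
  · exact hmin x hx hxc
  · refine (hmin 1 one_pos (le_max_left _ _)).trans ?_
    have h1 := (le_max_right 1 (levelPotential d β a b 1 / a)).trans hxc.le
    rw [div_le_iff₀ ha] at h1
    have h2 := mul_nonpos_of_nonneg_of_nonpos h.le (sBeta_nonpos hd hβ hx)
    refine h1.trans ?_
    unfold levelPotential
    linarith

/-- Substituting `x = p₀'(s)` turns `μ_t` into the infimum of the level potential over `x < ϱ_c`.
Nothing is lost: at and beyond `ϱ_c` the level potential is `a x`, bounded below by its left limit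
at `ϱ_c`. -/
lemma isGLB_muT (hd : 1 ≤ d) (hβ : 0 < β) (hb : 0 < b) (hab : b < a) :
    ∃ z, 0 < z ∧ (∀ x, 0 < x → levelPotential d β a b z ≤ levelPotential d β a b x) ∧
      levelPotential d β a b z = muT d β a b := by
  have ha := hb.trans hab
  obtain ⟨z, hz, hmin⟩ := exists_levelPotential_global_min hd hβ hb hab
  refine ⟨z, hz, hmin, Eq.symm ?_⟩
  have hval : ∀ s < 0, a * idealPressureDeriv d β s - (a - b) / b * s =
      levelPotential d β a b (density d β s) := fun s hs => by
    unfold levelPotential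
    rw [idealPressureDeriv_eq hd hβ hs, sBeta_density hd hβ hs]
  refine IsGLB.csInf_eq ⟨?_, ?_⟩ ⟨_, mem_image_of_mem _ (show (-1 : ℝ) ∈ Iio 0 by simp)⟩
  · rintro _ ⟨s, hs, rfl⟩
    simp only
    rw [hval s hs]
    exact hmin _ (density_pos hβ hs)
  · intro c hc
    have hcx : ∀ x : ℝ, 0 < x → (x : EReal) < criticalDensity d β → c ≤ levelPotential d β a b x := by
      intro x hx hxc
      obtain ⟨h1, h2⟩ := sBeta_spec hd hβ hx hxc
      have := hc (mem_image_of_mem _ (mem_Iio.2 h1))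
      rwa [hval _ h1, h2] at this
    rcases lt_or_ge (z : EReal) (criticalDensity d β) with h | h
    · exact hcx z hz h
    · have h3 := three_le_of_criticalDensity_le h
      have hcrit := criticalDensity_eq (d := d) hβ h3
      set ρ := density d β 0
      have hρ : 0 < ρ := (density_pos hβ (by norm_num : (-1 : ℝ) < 0)).trans
        (density_lt_density hβ (by norm_num) (Or.inr ⟨rfl, h3⟩))
      have hlim : Tendsto (levelPotential d β a b) (𝓝[<] ρ) (𝓝 (levelPotential d β a b ρ)) :=
        ((continuousOn_levelPotential hd hβ).continuousAt (Ioi_mem_nhds hρ)).tendsto.mono_left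
          nhdsWithin_le_nhds
      have hle : c ≤ levelPotential d β a b ρ := by
        refine ge_of_tendsto hlim ?_
        filter_upwards [self_mem_nhdsWithin, nhdsWithin_le_nhds (lt_mem_nhds hρ)] with x hx hx0
        refine hcx x hx0 ?_
        rw [hcrit]
        exact EReal.coe_lt_coe_iff.2 hx
      refine hle.trans ?_
      unfold levelPotential
      rw [sBeta_eq_zero h, sBeta_eq_zero hcrit.le]
      rw [hcrit, EReal.coe_le_coe_iff] at h
      nlinarith

lemma muT_le_levelPotential (hd : 1 ≤ d) (hβ : 0 < β) (hb : 0 < b) (hab : b < a) {x : ℝ}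
    (hx : 0 < x) : muT d β a b ≤ levelPotential d β a b x := by
  obtain ⟨z, -, hmin, hz⟩ := isGLB_muT (d := d) hd hβ hb hab
  exact hz ▸ hmin x hx

lemma isLeast_xTwo (hd : 1 ≤ d) (hβ : 0 < β) (hb : 0 < b) (hab : b < a) {μ : ℝ}
    (hμ : muT d β a b ≤ μ) : IsLeast (xTwoSolutions d β a b μ) (xTwo d β a b μ) := by
  obtain ⟨z, hz, -, hzT⟩ := isGLB_muT (d := d) hd hβ hb hab
  obtain ⟨x₀, hx₀, -, hx₀μ⟩ := exists_levelPotential_eq hd hβ hb hab hz (hzT.trans_le hμ)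
  obtain ⟨δ, hδ, hs⟩ := exists_forall_le_levelPotential hd hβ hb hab (μ + 1)
  have hδx : ∀ x, x ∈ xTwoSolutions d β a b μ → δ ≤ x := by
    intro x hx
    rw [mem_xTwoSolutions_iff hb hab] at hx
    by_contra h
    have := hs x hx.1 (not_le.1 h).le
    linarith [hx.2]
  have hx₀m : x₀ ∈ xTwoSolutions d β a b μ := (mem_xTwoSolutions_iff hb hab).2 ⟨hx₀, hx₀μ⟩
  have hclosed : IsClosed (Icc δ x₀ ∩ levelPotential d β a b ⁻¹' {μ}) :=
    ((continuousOn_levelPotential hd hβ).mono fun x hx =>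
      hδ.trans_le hx.1).preimage_isClosed_of_isClosed isClosed_Icc isClosed_singleton
  obtain ⟨x, ⟨hx, hxμ⟩, hxmin⟩ :=
    (isCompact_Icc.of_isClosed_subset hclosed inter_subset_left).exists_isLeast
      ⟨x₀, ⟨hδx _ hx₀m, le_rfl⟩, hx₀μ⟩
  have hleast : IsLeast (xTwoSolutions d β a b μ) x := by
    refine ⟨(mem_xTwoSolutions_iff hb hab).2 ⟨hδ.trans_le hx.1, hxμ⟩, fun y hy => ?_⟩
    rcases le_or_gt y x₀ with h | h
    · exact hxmin ⟨⟨hδx y hy, h⟩, ((mem_xTwoSolutions_iff hb hab).1 hy).2⟩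
    · exact hx.2.trans h.le
  rw [xTwo, hleast.csInf_eq]
  exact hleast

lemma mem_muRSet_iff (hb : 0 < b) (hab : b < a) {κ μ : ℝ} :
    μ ∈ muRSet d β a b κ ↔
      muT d β a b ≤ μ ∧ κ ≤ (μ - a * xTwo d β a b μ) / (a - b) := by
  have h : 0 < a - b := sub_pos.2 hab
  unfold muRSet
  rw [mem_ofPred_eq, le_div_iff₀ h, one_div_mul_eq_div, le_div_iff₀ (hb.trans hab)]
  refine and_congr_right fun _ => ⟨fun _ => by linarith, fun _ => by linarith⟩

/-- Any solution may replace the minimal one: `s_β` is monotone, so the minimal solution inherits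
the bound `-bκ`, which says that its condensate is at least `κ`. -/
lemma mem_muRSet_iff_exists (hd : 1 ≤ d) (hβ : 0 < β) (hb : 0 < b) (hab : b < a) {κ μ : ℝ} :
    μ ∈ muRSet d β a b κ ↔
      ∃ x, 0 < x ∧ sBeta d β x ≤ -(b * κ) ∧ levelPotential d β a b x = μ := by
  have h : 0 < a - b := sub_pos.2 hab
  have hy : muT d β a b ≤ μ → sBeta d β (xTwo d β a b μ) =
      -(b * ((μ - a * xTwo d β a b μ) / (a - b))) := fun hμ => by
    rw [(isLeast_xTwo hd hβ hb hab hμ).1.2]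
    ring
  rw [mem_muRSet_iff hb hab]
  constructor
  · rintro ⟨hμ, hκ⟩
    have h2 := (mem_xTwoSolutions_iff hb hab).1 (isLeast_xTwo hd hβ hb hab hμ).1
    refine ⟨_, h2.1, ?_, h2.2⟩
    rw [hy hμ]
    nlinarith
  · rintro ⟨x, hx, hxs, rfl⟩
    have hμ := muT_le_levelPotential hd hβ hb hab hx
    have hl := isLeast_xTwo hd hβ hb hab hμ
    refine ⟨hμ, ?_⟩
    have h1 := sBeta_mono hd hβ hl.1.1
      (hl.2 ((mem_xTwoSolutions_iff hb hab).2 ⟨hx, rfl⟩))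
    have h2 := (hy hμ).symm.trans_le (h1.trans hxs)
    exact le_of_mul_le_mul_left (by linarith) hb

/-- By `mem_muRSet_iff_exists` the set is the image under the level potential of an interval `(0,
c]`, with `c` the density at `-bκ`. The level potential is continuous, tends to `+∞` at `0` and has
a minimum on that interval, so the image is a closed half-line. -/
lemma muRSet_eq (hd : 1 ≤ d) (hβ : 0 < β) (hb : 0 < b) (hab : b < a) {κ : ℝ} (hκ : 0 < κ) :
    muRSet d β a b κ = Ici (muR d β a b κ) := by
  have hbκ : -(b * κ) < 0 := neg_neg_of_pos (mul_pos hb hκ)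
  obtain ⟨z, hz, hzc, hmin⟩ :=
    exists_levelPotential_min hd hβ hb hab (density_pos (d := d) hβ hbκ)
  have hset : muRSet d β a b κ = Ici (levelPotential d β a b z) := by
    ext μ
    rw [mem_muRSet_iff_exists hd hβ hb hab, mem_Ici]
    constructor
    · rintro ⟨x, hx, hxs, rfl⟩
      exact hmin x hx ((sBeta_le_iff hd hβ hx hbκ).1 hxs)
    · intro h
      obtain ⟨x, hx, hxz, hxμ⟩ := exists_levelPotential_eq hd hβ hb hab hz h
      exact ⟨x, hx, (sBeta_le_iff hd hβ hx hbκ).2 (hxz.trans hzc), hxμ⟩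
  rw [muR, hset, csInf_Ici]

end Solutions

/-! ### The energy and its domain. -/

/-- The quadratic part of the energy at `p = (x,y)`. -/
def interaction (a b μ : ℝ) (p : ℝ × ℝ) : ℝ :=
  -μ * (p.1 + p.2) + a / 2 * (p.1 + p.2) ^ 2 - b / 2 * p.2 ^ 2

/-- The rate function without its normalisation. -/
def energy (d : ℕ) (β a b μ : ℝ) (p : ℝ × ℝ) : ℝ :=
  freeEnergyReal d β p.1 + interaction a b μ p

/-- `p` minimises the energy on `𝕂(κ)`. -/
def IsMinimizer (d : ℕ) (β a b : ℝ) (κ : ℝ≥0∞) (μ : ℝ) (p : ℝ × ℝ) : Prop :=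
  p ∈ stateSpace κ ∧ ∀ q ∈ stateSpace κ, energy d β a b μ p ≤ energy d β a b μ q

section StateSpace

variable {κ : ℝ≥0∞}

lemma nonneg_of_mem_stateSpace {p : ℝ × ℝ} (hp : p ∈ stateSpace κ) : 0 ≤ p.1 ∧ 0 ≤ p.2 := by
  obtain ⟨h1, h2 | h2⟩ := hp
  · exact ⟨h1, h2.ge⟩
  · exact ⟨h1, h2.1⟩

lemma mem_stateSpace_zero_right {x : ℝ} (hx : 0 ≤ x) : (x, (0 : ℝ)) ∈ stateSpace κ :=
  ⟨hx, Or.inl rfl⟩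

lemma mem_stateSpace_of_le {x y : ℝ} (hx : 0 ≤ x) (hy : 0 ≤ y) (h : κ ≤ ENNReal.ofReal y) :
    (x, y) ∈ stateSpace κ :=
  ⟨hx, Or.inr ⟨hy, h⟩⟩

lemma le_of_mem_stateSpace {p : ℝ × ℝ} (hp : p ∈ stateSpace κ) (hy : 0 < p.2) :
    κ ≤ ENNReal.ofReal p.2 := by
  obtain ⟨-, h | h⟩ := hp
  · exact absurd h hy.ne'
  · exact h.2

lemma mem_stateSpace_congr {p : ℝ × ℝ} (hp : p ∈ stateSpace κ) {x : ℝ} (hx : 0 ≤ x) :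
    (x, p.2) ∈ stateSpace κ :=
  ⟨hx, hp.2⟩

lemma isClosed_stateSpace : IsClosed (stateSpace κ) := by
  have h : stateSpace κ = {p : ℝ × ℝ | 0 ≤ p.1} ∩ ({p : ℝ × ℝ | p.2 = 0} ∪
      ({p : ℝ × ℝ | 0 ≤ p.2} ∩ {p : ℝ × ℝ | κ ≤ ENNReal.ofReal p.2})) := rfl
  rw [h]
  refine (isClosed_le continuous_const continuous_fst).inter
    ((isClosed_eq continuous_snd continuous_const).union
      ((isClosed_le continuous_const continuous_snd).inter
        (isClosed_le continuous_const (ENNReal.continuous_ofReal.comp continuous_snd))))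

lemma stateSpace_mono {κ' : ℝ≥0∞} (h : κ' ≤ κ) : stateSpace κ ⊆ stateSpace κ' := by
  rintro p ⟨h1, h2⟩
  exact ⟨h1, h2.imp_right fun h3 => ⟨h3.1, h.trans h3.2⟩⟩

end StateSpace

/-! ### Existence, stationarity and ordering of minimisers. -/

section Minimizers

variable {d : ℕ} {β a b : ℝ} {κ : ℝ≥0∞} {μ : ℝ}

lemma energy_lower_bound (hd : 1 ≤ d) (hβ : 0 < β) (hb : 0 < b) {p : ℝ × ℝ}
    (hp : p ∈ stateSpace κ) :
    -pressureReal d β 0 - μ * (p.1 + p.2) + (a - b) / 2 * (p.1 + p.2) ^ 2 ≤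
      energy d β a b μ p := by
  obtain ⟨h1, h2⟩ := nonneg_of_mem_stateSpace hp
  have h3 := neg_pressureReal_le hd hβ h1
  have h4 : p.2 ^ 2 ≤ (p.1 + p.2) ^ 2 := by gcongr; linarith
  unfold energy interaction
  nlinarith

/-- Coercivity, uniform in `μ ≤ M`. Once `x + y > 1`, the constant `p₀(0)` is absorbed into a term
linear in `x + y`, which the quadratic term then beats. -/
lemma add_le_of_energy_nonpos (hd : 1 ≤ d) (hβ : 0 < β) (hb : 0 < b) (hab : b < a) {p : ℝ × ℝ}
    (hp : p ∈ stateSpace κ) {M : ℝ} (hM : μ ≤ M) (hE : energy d β a b μ p ≤ 0) :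
    p.1 + p.2 ≤ max 1 (2 * (pressureReal d β 0 + M) / (a - b)) := by
  have h : 0 < a - b := sub_pos.2 hab
  obtain ⟨h1, h2⟩ := nonneg_of_mem_stateSpace hp
  have h3 := energy_lower_bound (a := a) (μ := μ) hd hβ hb hp
  have h4 := pressureReal_nonneg (d := d) hβ 0
  by_contra! hN
  obtain ⟨hN1, hN2⟩ := max_lt_iff.1 hN
  rw [div_lt_iff₀ h] at hN2
  have h5 : μ * (p.1 + p.2) ≤ M * (p.1 + p.2) := by gcongr
  have h6 : pressureReal d β 0 * 1 ≤ pressureReal d β 0 * (p.1 + p.2) := by gcongr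
  nlinarith [mul_lt_mul_of_pos_right hN2 (zero_lt_one.trans hN1)]

lemma energy_zero_nonpos (hd : 1 ≤ d) (hβ : 0 < β) :
    energy d β a b μ ((0 : ℝ), (0 : ℝ)) ≤ 0 := by
  have := freeEnergyReal_nonpos (d := d) hd hβ le_rfl
  unfold energy interaction
  simpa using this

lemma IsMinimizer.energy_nonpos (hd : 1 ≤ d) (hβ : 0 < β) {p : ℝ × ℝ}
    (hp : IsMinimizer d β a b κ μ p) : energy d β a b μ p ≤ 0 :=
  (hp.2 _ (mem_stateSpace_zero_right le_rfl)).trans (energy_zero_nonpos hd hβ)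

lemma continuous_interaction : Continuous fun q : ℝ × (ℝ × ℝ) => interaction a b q.1 q.2 := by
  unfold interaction
  fun_prop

lemma exists_isMinimizer (hd : 1 ≤ d) (hβ : 0 < β) (hb : 0 < b) (hab : b < a) :
    ∃ p, IsMinimizer d β a b κ μ p := by
  set R := max 1 (2 * (pressureReal d β 0 + μ) / (a - b))
  have hR : 0 ≤ R := zero_le_one.trans (le_max_left _ _)
  have hcompact : IsCompact (stateSpace κ ∩ Icc (0 : ℝ) R ×ˢ Icc (0 : ℝ) R) :=
    (isCompact_Icc.prod isCompact_Icc).inter_left isClosed_stateSpace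
  have hlsc : LowerSemicontinuousOn (energy d β a b μ)
      (stateSpace κ ∩ Icc (0 : ℝ) R ×ˢ Icc (0 : ℝ) R) := by
    have hc : Continuous (interaction a b μ) := by
      unfold interaction
      fun_prop
    exact ((lowerSemicontinuousOn_freeEnergyReal hd hβ).comp continuousOn_fst fun p hp =>
      (nonneg_of_mem_stateSpace hp.1).1).add (hc.lowerSemicontinuous.lowerSemicontinuousOn _)
  have hne : (stateSpace κ ∩ Icc (0 : ℝ) R ×ˢ Icc (0 : ℝ) R).Nonempty :=
    ⟨((0 : ℝ), (0 : ℝ)), mem_stateSpace_zero_right le_rfl, ⟨le_rfl, hR⟩, ⟨le_rfl, hR⟩⟩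
  obtain ⟨p, hp, hmin⟩ := LowerSemicontinuousOn.exists_isMinOn hne hcompact hlsc
  refine ⟨p, hp.1, fun q hq => ?_⟩
  obtain ⟨hq1, hq2⟩ := nonneg_of_mem_stateSpace hq
  rcases le_or_gt (energy d β a b μ q) 0 with h | h
  · have hN := add_le_of_energy_nonpos hd hβ hb hab hq le_rfl h
    exact hmin ⟨hq, ⟨hq1, by linarith⟩, ⟨hq2, by linarith⟩⟩
  · refine le_trans ?_ h.le
    refine le_trans (hmin ?_) (energy_zero_nonpos (a := a) (b := b) (μ := μ) hd hβ)
    exact ⟨mem_stateSpace_zero_right le_rfl, ⟨le_rfl, hR⟩, ⟨le_rfl, hR⟩⟩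

lemma exists_isMinimizer_of_tendsto (hd : 1 ≤ d) (hβ : 0 < β) (hb : 0 < b) (hab : b < a)
    {ν : ℕ → ℝ} (hν : Tendsto ν atTop (𝓝 μ)) {p : ℕ → ℝ × ℝ}
    (hp : ∀ n, IsMinimizer d β a b κ (ν n) (p n)) :
    ∃ (q : ℝ × ℝ) (φ : ℕ → ℕ), IsMinimizer d β a b κ μ q ∧ StrictMono φ ∧
      Tendsto (p ∘ φ) atTop (𝓝 q) := by
  obtain ⟨M, hM⟩ := hν.bddAbove_range
  set R := max 1 (2 * (pressureReal d β 0 + M) / (a - b))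
  have hmem : ∀ n, p n ∈ Icc (0 : ℝ) R ×ˢ Icc (0 : ℝ) R := fun n => by
    obtain ⟨h1, h2⟩ := nonneg_of_mem_stateSpace (hp n).1
    have := add_le_of_energy_nonpos hd hβ hb hab (hp n).1 (hM (mem_range_self n))
      ((hp n).energy_nonpos hd hβ)
    exact ⟨⟨h1, by linarith⟩, ⟨h2, by linarith⟩⟩
  obtain ⟨q, -, φ, hφ, hlim⟩ := (isCompact_Icc.prod isCompact_Icc).tendsto_subseq hmem
  have hq : q ∈ stateSpace κ :=
    isClosed_stateSpace.mem_of_tendsto hlim (Eventually.of_forall fun n => (hp (φ n)).1)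
  have hνφ : Tendsto (ν ∘ φ) atTop (𝓝 μ) := hν.comp hφ.tendsto_atTop
  refine ⟨q, φ, ⟨hq, fun r hr => ?_⟩, hφ, hlim⟩
  by_contra! hlt
  unfold energy at hlt
  -- The free energy is used only through lower semicontinuity: eventually it exceeds `c` along the
  -- sequence, while the interaction converges jointly in `μ` and the point.
  obtain ⟨c, hc1, hc2⟩ := exists_between (sub_lt_iff_lt_add.2 hlt)
  have h1 : Tendsto (fun n => (p (φ n)).1) atTop (𝓝[Ici 0] q.1) :=
    tendsto_nhdsWithin_iff.2 ⟨(continuous_fst.tendsto q).comp hlim,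
      Eventually.of_forall fun n => (nonneg_of_mem_stateSpace (hp (φ n)).1).1⟩
  have h2 := h1.eventually (lowerSemicontinuousOn_freeEnergyReal hd hβ q.1
    (nonneg_of_mem_stateSpace hq).1 c hc2)
  have h3 : Tendsto (fun n => c + interaction a b (ν (φ n)) (p (φ n))) atTop
      (𝓝 (c + interaction a b μ q)) :=
    ((continuous_interaction.tendsto (μ, q)).comp (hνφ.prodMk_nhds hlim)).const_add c
  have h4 : Tendsto (fun n => freeEnergyReal d β r.1 + interaction a b (ν (φ n)) r) atTop
      (𝓝 (freeEnergyReal d β r.1 + interaction a b μ r)) :=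
    ((continuous_interaction.tendsto (μ, r)).comp
      (hνφ.prodMk_nhds tendsto_const_nhds)).const_add _
  have h5 := le_of_tendsto_of_tendsto h3 h4 (h2.mono fun n hn => by
    have := (hp (φ n)).2 r hr
    unfold energy at this
    linarith)
  linarith

lemma zeroSet_eq (hd : 1 ≤ d) (hβ : 0 < β) (hb : 0 < b) (hab : b < a) :
    zeroSet d β a b κ μ = {p | IsMinimizer d β a b κ μ p} := by
  obtain ⟨p₀, hp₀⟩ := exists_isMinimizer (d := d) (μ := μ) (κ := κ) hd hβ hb hab
  have hterm : ∀ q ∈ stateSpace κ,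
      ((μ * (q.1 + q.2) - a / 2 * (q.1 + q.2) ^ 2 + b / 2 * q.2 ^ 2 : ℝ) : EReal)
        - freeEnergy d β q.1 = ((-energy d β a b μ q : ℝ) : EReal) := fun q hq => by
    rw [← coe_freeEnergyReal hd hβ (nonneg_of_mem_stateSpace hq).1, ← EReal.coe_sub]
    congr 1
    unfold energy interaction
    ring
  have hpress : pressure d β a b κ μ = ((-energy d β a b μ p₀ : ℝ) : EReal) := by
    unfold pressure
    refine le_antisymm (iSup₂_le fun q hq => ?_) ?_
    · rw [hterm q hq, EReal.coe_le_coe_iff]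
      linarith [hp₀.2 q hq]
    · rw [← hterm p₀ hp₀.1]
      exact le_iSup₂ (f := fun (p : ℝ × ℝ) (_ : p ∈ stateSpace κ) =>
        ((μ * (p.1 + p.2) - a / 2 * (p.1 + p.2) ^ 2 + b / 2 * p.2 ^ 2 : ℝ) : EReal)
          - freeEnergy d β p.1) p₀ hp₀.1
  ext p
  change rateFunction d β a b κ μ p = 0 ↔ IsMinimizer d β a b κ μ p
  unfold rateFunction
  by_cases hp : p ∈ stateSpace κ
  · rw [if_pos hp, hpress, ← coe_freeEnergyReal hd hβ (nonneg_of_mem_stateSpace hp).1,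
      ← EReal.coe_add, ← EReal.coe_add, EReal.coe_eq_zero]
    have h : freeEnergyReal d β p.1 + (-μ * (p.1 + p.2) + a / 2 * (p.1 + p.2) ^ 2
        - b / 2 * p.2 ^ 2) = energy d β a b μ p := rfl
    rw [h]
    constructor
    · intro h0
      exact ⟨hp, fun q hq => by linarith [hp₀.2 q hq]⟩
    · intro hmin
      linarith [hmin.2 p₀ hp₀.1, hp₀.2 p hp]
  · rw [if_neg hp]
    exact ⟨fun h => absurd h EReal.top_ne_zero, fun h => absurd h.1 hp⟩

lemma IsMinimizer.fst_eq (hd : 1 ≤ d) (hβ : 0 < β) (ha : 0 < a) {p : ℝ × ℝ}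
    (hp : IsMinimizer d β a b κ μ p) : p.1 = xOne d β a (μ - a * p.2) := by
  obtain ⟨hz, hs⟩ := xOne_spec (d := d) hd hβ ha (μ - a * p.2)
  set z := xOne d β a (μ - a * p.2)
  -- Comparing with the stationary point `z` at the same `y`: the subgradient at `z` cancels the
  -- linear terms and leaves `a/2 (x - z)² ≤ 0`.
  have h1 := hp.2 _ (mem_stateSpace_congr hp.1 hz.le)
  have h2 := freeEnergyReal_subgradient hd hβ hz (nonneg_of_mem_stateSpace hp.1).1
  rw [hs] at h2
  unfold energy interaction at h1
  simp only at h1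
  have h3 : a / 2 * (p.1 - z) ^ 2 ≤ 0 := by nlinarith
  have h4 : (p.1 - z) ^ 2 ≤ 0 := by
    by_contra! h
    have : 0 < a / 2 * (p.1 - z) ^ 2 := by positivity
    linarith
  have h5 := pow_eq_zero_iff (two_ne_zero) |>.1 (le_antisymm h4 (sq_nonneg _))
  linarith

lemma IsMinimizer.fst_pos (hd : 1 ≤ d) (hβ : 0 < β) (ha : 0 < a) {p : ℝ × ℝ}
    (hp : IsMinimizer d β a b κ μ p) : 0 < p.1 := by
  rw [hp.fst_eq hd hβ ha]
  exact (xOne_spec hd hβ ha _).1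

lemma IsMinimizer.sBeta_eq (hd : 1 ≤ d) (hβ : 0 < β) (ha : 0 < a) {p : ℝ × ℝ}
    (hp : IsMinimizer d β a b κ μ p) : sBeta d β p.1 = μ - a * (p.1 + p.2) := by
  have h := (xOne_spec (d := d) hd hβ ha (μ - a * p.2)).2
  rw [← hp.fst_eq hd hβ ha] at h
  linarith

lemma IsMinimizer.eq_pointOne (hd : 1 ≤ d) (hβ : 0 < β) (ha : 0 < a) {p : ℝ × ℝ}
    (hp : IsMinimizer d β a b κ μ p) (hy : p.2 = 0) : p = pointOne d β a μ := by
  have h := hp.fst_eq hd hβ ha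
  rw [hy, mul_zero, sub_zero] at h
  exact Prod.ext h hy

lemma energy_snd_sub (x y y' : ℝ) : energy d β a b μ (x, y') - energy d β a b μ (x, y) =
    (y' - y) * (-μ + a * x + (a - b) * y) + (a - b) / 2 * (y' - y) ^ 2 := by
  unfold energy interaction
  ring

lemma IsMinimizer.sBeta_le (hd : 1 ≤ d) (hβ : 0 < β) (hb : 0 < b) (hab : b < a) {p : ℝ × ℝ}
    (hp : IsMinimizer d β a b κ μ p) (hy : 0 < p.2) : sBeta d β p.1 ≤ -(b * p.2) := by
  have h : 0 < a - b := sub_pos.2 hab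
  rw [hp.sBeta_eq hd hβ (hb.trans hab)]
  by_contra! hc
  -- `c` is minus the `y`-derivative of the energy, and `y + c/(a-b)` is the vertex of the parabola.
  -- Raising a positive `y` never leaves the state space.
  set c := μ - a * p.1 - (a - b) * p.2
  have hc0 : 0 < c := by simp only [c]; linarith
  have ht : 0 < c / (a - b) := div_pos hc0 h
  have h1 := hp.2 (p.1, p.2 + c / (a - b)) (mem_stateSpace_of_le
    (nonneg_of_mem_stateSpace hp.1).1 (by linarith)
    ((le_of_mem_stateSpace hp.1 hy).trans (ENNReal.ofReal_le_ofReal (by linarith))))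
  have h2 := energy_snd_sub (d := d) (β := β) (a := a) (b := b) (μ := μ) p.1 p.2
    (p.2 + c / (a - b))
  have h3 : (a - b) / 2 * (p.2 + c / (a - b) - p.2) ^ 2 = c / (a - b) * c / 2 := by
    field_simp
    ring
  have h4 : -μ + a * p.1 + (a - b) * p.2 = -c := by simp only [c]; ring
  rw [h3, h4] at h2
  nlinarith [mul_pos ht hc0]

lemma IsMinimizer.sBeta_eq_of_lt (hd : 1 ≤ d) (hβ : 0 < β) (hb : 0 < b) (hab : b < a)
    {p : ℝ × ℝ} (hp : IsMinimizer d β a b κ μ p) (hy : κ < ENNReal.ofReal p.2) :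
    sBeta d β p.1 = -(b * p.2) := by
  have h : 0 < a - b := sub_pos.2 hab
  have hκ : κ ≠ ⊤ := hy.ne_top
  have hκy : κ.toReal < p.2 := (ENNReal.lt_ofReal_iff_toReal_lt hκ).1 hy
  have hκ0 : 0 ≤ κ.toReal := ENNReal.toReal_nonneg
  refine le_antisymm (hp.sBeta_le hd hβ hb hab (hκ0.trans_lt hκy)) ?_
  rw [hp.sBeta_eq hd hβ (hb.trans hab)]
  by_contra! hc
  set c := -μ + a * p.1 + (a - b) * p.2 with hcdef
  have hc0 : 0 < c := by simp only [c]; linarith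
  -- The step down to the vertex, cut off so that `y - t` stays at least `κ`.
  set t := min (c / (a - b)) (p.2 - κ.toReal) with htdef
  have ht : 0 < t := lt_min (div_pos hc0 h) (sub_pos.2 hκy)
  have ht1 : t ≤ c / (a - b) := min_le_left _ _
  have ht2 : t ≤ p.2 - κ.toReal := min_le_right _ _
  rw [le_div_iff₀ h] at ht1
  have h1 := hp.2 (p.1, p.2 - t) (mem_stateSpace_of_le
    (nonneg_of_mem_stateSpace hp.1).1 (by linarith)
    (ENNReal.le_ofReal_iff_toReal_le hκ (by linarith) |>.2 (by linarith)))
  have h2 := energy_snd_sub (d := d) (β := β) (a := a) (b := b) (μ := μ) p.1 p.2 (p.2 - t)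
  rw [← hcdef] at h2
  nlinarith [mul_pos ht hc0]

/-- The condensed phase persists as `μ` grows. If `q` had no condensate, transferring the condensate
of `p` to `q` at fixed total masses would leave the sum of interactions unchanged and contradict
strict convexity of the free energy. -/
lemma not_isMinimizer_of_lt (hd : 1 ≤ d) (hβ : 0 < β) (hb : 0 < b) (hab : b < a) {p : ℝ × ℝ}
    (hp : IsMinimizer d β a b κ μ p) (hy : 0 < p.2) {μ' : ℝ} (hμ : μ < μ') {q : ℝ × ℝ}
    (hq : IsMinimizer d β a b κ μ' q) : 0 < q.2 := by
  refine (nonneg_of_mem_stateSpace hq.1).2.lt_of_ne' fun hq0 => ?_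
  have ha := hb.trans hab
  have hx := hp.fst_pos hd hβ ha
  have hz := hq.fst_pos hd hβ ha
  have hqeq : q = (q.1, (0 : ℝ)) := Prod.ext rfl hq0
  have h1 := hp.2 q (hqeq ▸ mem_stateSpace_zero_right hz.le)
  have h2 := hq.2 (p.1, p.2) hp.1
  -- Adding the two minimality inequalities gives monotonicity of the total mass in `μ`. Equal
  -- masses would make `q` a minimiser at both potentials, against stationarity in `x`.
  have hle : p.1 + p.2 ≤ q.1 := by
    unfold energy interaction at h1 h2
    simp only [hq0] at h1 h2
    nlinarith
  have hlt : p.1 + p.2 < q.1 := by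
    refine hle.lt_of_ne fun he => ?_
    have hs := hq.sBeta_eq hd hβ ha
    have hq' : IsMinimizer d β a b κ μ q := by
      refine ⟨hq.1, fun r hr => le_trans ?_ (hp.2 r hr)⟩
      unfold energy interaction at h2 ⊢
      simp only [hq0] at h2 ⊢
      rw [he] at h2 ⊢
      linarith
    have hs' := hq'.sBeta_eq hd hβ ha
    linarith
  have h3 := hp.2 (p.1 + p.2, (0 : ℝ)) (mem_stateSpace_zero_right (by linarith))
  have h4 := hq.2 (q.1 - p.2, p.2) (mem_stateSpace_congr hp.1 (by linarith))
  unfold energy interaction at h3 h4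
  simp only [hq0] at h3 h4
  have h5 : freeEnergyReal d β p.1 + freeEnergyReal d β q.1 ≤
      freeEnergyReal d β (p.1 + p.2) + freeEnergyReal d β (q.1 - p.2) := by nlinarith
  have hsx : sBeta d β p.1 < 0 :=
    (hp.sBeta_le hd hβ hb hab hy).trans_lt (neg_neg_of_pos (mul_pos hb hy))
  -- The points `x + y` and `z - y` lie strictly between `x` and `z = q.1`. Weighting the tangent
  -- inequalities by the two distances eliminates the slopes and yields `f(x+y) + f(z-y) < f(x) +
  -- f(z)`.
  have h6 := freeEnergyReal_strict_subgradient hd hβ hx (w := p.1 + p.2) (by linarith) hsx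
  have h7 := freeEnergyReal_subgradient hd hβ (x := p.1 + p.2) (by linarith) hz.le
  have h8 := freeEnergyReal_strict_subgradient hd hβ hx (w := q.1 - p.2) (by linarith) hsx
  have h9 := freeEnergyReal_subgradient hd hβ (x := q.1 - p.2) (by linarith) hz.le
  have ht : 0 < q.1 - p.2 - p.1 := by linarith
  nlinarith [mul_lt_mul_of_pos_left h6 ht, mul_le_mul_of_nonneg_left h7 hy.le,
    mul_lt_mul_of_pos_left h8 hy, mul_le_mul_of_nonneg_left h9 ht.le]

/-- The transition between the phases `y = 0` and `y > 0`. -/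
lemma exists_threshold (hd : 1 ≤ d) (hβ : 0 < β) (hb : 0 < b) (hab : b < a)
    (hne : ∃ μ, IsMinimizer d β a b κ μ (pointOne d β a μ))
    (hbdd : ∃ μ, ∀ p, IsMinimizer d β a b κ μ p → 0 < p.2) :
    ∃ μs, (∀ μ ≤ μs, IsMinimizer d β a b κ μ (pointOne d β a μ)) ∧
      (∀ μ < μs, ∀ p, IsMinimizer d β a b κ μ p → p.2 = 0) ∧
      (∀ μ > μs, ∀ p, IsMinimizer d β a b κ μ p → 0 < p.2) := by
  have ha := hb.trans hab
  set B := {μ | IsMinimizer d β a b κ μ (pointOne d β a μ)}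
  have hdown : ∀ μ ∈ B, ∀ μ' < μ, ∀ p, IsMinimizer d β a b κ μ' p → p.2 = 0 := by
    intro μ hμ μ' hμ' p hp
    refine ((nonneg_of_mem_stateSpace hp.1).2.eq_or_lt).elim Eq.symm fun h => ?_
    exact absurd (not_isMinimizer_of_lt hd hβ hb hab hp h hμ' hμ) (lt_irrefl _)
  have hmem : ∀ {μ}, (∃ p, IsMinimizer d β a b κ μ p ∧ p.2 = 0) → μ ∈ B := by
    rintro μ ⟨p, hp, h0⟩
    have := hp.eq_pointOne hd hβ ha h0
    rwa [this] at hp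
  obtain ⟨M, hM⟩ := hbdd
  have hBdd : BddAbove B := ⟨M, fun μ hμ => by
    by_contra! h
    obtain ⟨p, hp⟩ := exists_isMinimizer (d := d) (μ := M) (κ := κ) hd hβ hb hab
    exact absurd (hdown μ hμ M h p hp) (hM p hp).ne'⟩
  have hlt : ∀ μ < sSup B, ∀ p, IsMinimizer d β a b κ μ p → p.2 = 0 := by
    intro μ hμ
    obtain ⟨μ', hμ', hlt⟩ := exists_lt_of_lt_csSup hne hμ
    exact hdown μ' hμ' μ hlt
  refine ⟨sSup B, ?_, hlt, ?_⟩
  · intro μ hμ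
    refine hmem ?_
    -- Approaching from below handles `μ = sSup B` too: the approximating minimisers all have `y =
    -- 0`, hence so does their limit.
    choose p hp using fun ν => exists_isMinimizer (d := d) (μ := ν) (κ := κ) hd hβ hb hab
    have hν : Tendsto (fun n : ℕ => μ - 1 / ((n : ℝ) + 1)) atTop (𝓝 μ) := by
      simpa using (tendsto_one_div_add_atTop_nhds_zero_nat (𝕜 := ℝ)).const_sub μ
    obtain ⟨q, φ, hq, -, hlim⟩ :=
      exists_isMinimizer_of_tendsto hd hβ hb hab hν (fun n => hp _)
    refine ⟨q, hq, ?_⟩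
    refine tendsto_nhds_unique ((continuous_snd.tendsto q).comp hlim) ?_
    refine tendsto_const_nhds.congr fun n => ?_
    refine (hlt _ (lt_of_lt_of_le ?_ hμ) _ (hp _)).symm
    have : (0 : ℝ) < 1 / ((φ n : ℝ) + 1) := by positivity
    linarith
  · intro μ hμ p hp
    refine (nonneg_of_mem_stateSpace hp.1).2.lt_of_ne' fun h0 => ?_
    exact absurd (le_csSup hBdd (hmem ⟨p, hp, h0⟩)) (not_le.2 hμ)

end Minimizers

/-! ### The phase diagram. -/

section ZeroSets

variable {d : ℕ} {β a b : ℝ} {κ : ℝ≥0∞} {μ : ℝ}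

lemma mem_zeroSet (hd : 1 ≤ d) (hβ : 0 < β) (hb : 0 < b) (hab : b < a) {p : ℝ × ℝ} :
    p ∈ zeroSet d β a b κ μ ↔ IsMinimizer d β a b κ μ p := by
  rw [zeroSet_eq hd hβ hb hab]
  rfl

lemma zeroSet_eq_singleton (hd : 1 ≤ d) (hβ : 0 < β) (hb : 0 < b) (hab : b < a) {r : ℝ × ℝ}
    (h : ∀ p, IsMinimizer d β a b κ μ p → p = r) : zeroSet d β a b κ μ = {r} := by
  obtain ⟨p, hp⟩ := exists_isMinimizer (d := d) (μ := μ) (κ := κ) hd hβ hb hab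
  ext q
  rw [mem_zeroSet hd hβ hb hab, mem_singleton_iff]
  refine ⟨h q, ?_⟩
  rintro rfl
  exact h p hp ▸ hp

lemma zeroSet_eq_pair (hd : 1 ≤ d) (hβ : 0 < β) (hb : 0 < b) (hab : b < a) {r s : ℝ × ℝ}
    (h : ∀ p, IsMinimizer d β a b κ μ p → p = r ∨ p = s) (hr : IsMinimizer d β a b κ μ r)
    (hs : IsMinimizer d β a b κ μ s) : zeroSet d β a b κ μ = {r, s} := by
  ext q
  rw [mem_zeroSet hd hβ hb hab, mem_insert_iff, mem_singleton_iff]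
  refine ⟨h q, ?_⟩
  rintro (rfl | rfl)
  · exact hr
  · exact hs

/-- If one unconstrained minimiser survives the constraint, the two minimal values coincide. -/
lemma zeroSet_eq_inter (hd : 1 ≤ d) (hβ : 0 < β) (hb : 0 < b) (hab : b < a) {p : ℝ × ℝ}
    (hp : p ∈ zeroSet d β a b 0 μ) (hpκ : p ∈ stateSpace κ) :
    zeroSet d β a b κ μ = zeroSet d β a b 0 μ ∩ stateSpace κ := by
  have hsub := stateSpace_mono (zero_le (a := κ))
  rw [mem_zeroSet hd hβ hb hab] at hp
  ext q
  rw [mem_inter_iff, mem_zeroSet hd hβ hb hab, mem_zeroSet hd hβ hb hab]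
  constructor
  · intro hq
    exact ⟨⟨hsub hq.1, fun r hr => (hq.2 p hpκ).trans (hp.2 r hr)⟩, hq.1⟩
  · rintro ⟨hq, hqκ⟩
    exact ⟨hqκ, fun r hr => hq.2 r (hsub hr)⟩

lemma pointOne_mem_stateSpace (hd : 1 ≤ d) (hβ : 0 < β) (ha : 0 < a) :
    pointOne d β a μ ∈ stateSpace κ :=
  mem_stateSpace_zero_right (xOne_spec hd hβ ha μ).1.le

lemma zeroSet_top (hd : 1 ≤ d) (hβ : 0 < β) (hb : 0 < b) (hab : b < a) :
    zeroSet d β a b ⊤ μ = {pointOne d β a μ} := by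
  refine zeroSet_eq_singleton hd hβ hb hab fun p hp => hp.eq_pointOne hd hβ (hb.trans hab) ?_
  refine (nonneg_of_mem_stateSpace hp.1).2.eq_or_lt.elim Eq.symm fun h => ?_
  exact absurd (le_of_mem_stateSpace hp.1 h) (by simp)

lemma pointTwo_mem_stateSpace (hd : 1 ≤ d) (hβ : 0 < β) (hb : 0 < b) (hab : b < a)
    (hμ : muT d β a b ≤ μ) (hκ : κ ≤ ENNReal.ofReal (pointTwo d β a b μ).2) :
    pointTwo d β a b μ ∈ stateSpace κ := by
  obtain ⟨hx, hs⟩ := (isLeast_xTwo hd hβ hb hab hμ).1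
  have h1 := sBeta_nonpos hd hβ hx
  have h2 : sBeta d β (xTwo d β a b μ) = -(b * ((μ - a * xTwo d β a b μ) / (a - b))) := by
    rw [hs]
    ring
  refine mem_stateSpace_of_le hx.le ?_ hκ
  by_contra! h
  nlinarith

/-- Along the line `y = (μ - a x)/(a-b)` the interaction changes by minus the trapezoid integral of
an affine function that agrees with `s_β` at both solutions. The free energy gains strictly more, by
concavity of `s_β`. -/
lemma energy_pointTwo_lt (hd : 1 ≤ d) (hβ : 0 < β) (hb : 0 < b) (hab : b < a)
    (hμ : muT d β a b ≤ μ) {x : ℝ} (hx : x ∈ xTwoSolutions d β a b μ)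
    (hlt : xTwo d β a b μ < x) (hxc : (x : EReal) ≤ criticalDensity d β) :
    energy d β a b μ (pointTwo d β a b μ) < energy d β a b μ (x, (μ - a * x) / (a - b)) := by
  have h : a - b ≠ 0 := (sub_pos.2 hab).ne'
  obtain ⟨hx2, hs2⟩ := (isLeast_xTwo hd hβ hb hab hμ).1
  have htr := freeEnergyReal_trapezoid hd hβ hx2 hlt hxc
  rw [hs2, hx.2] at htr
  have hid : ∀ z : ℝ, interaction a b μ (x, (μ - a * x) / (a - b)) -
      interaction a b μ (z, (μ - a * z) / (a - b)) =
      -((-(b / (a - b)) * (μ - a * x) + -(b / (a - b)) * (μ - a * z)) * ((x - z) / 2)) := by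
    intro z
    unfold interaction
    field_simp
    ring
  have := hid (xTwo d β a b μ)
  unfold energy pointTwo
  simp only
  linarith

lemma mem_xTwoSolutions_of_eq (hab : b < a) {x y : ℝ} (hx : 0 < x)
    (h1 : sBeta d β x = μ - a * (x + y)) (h2 : sBeta d β x = -(b * y)) :
    x ∈ xTwoSolutions d β a b μ ∧ y = (μ - a * x) / (a - b) := by
  have h : 0 < a - b := sub_pos.2 hab
  have h3 : y = (μ - a * x) / (a - b) := by
    rw [eq_div_iff h.ne']
    linarith
  refine ⟨⟨hx, ?_⟩, h3⟩
  rw [h2, h3]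
  ring

lemma IsMinimizer.eq_pointTwo (hd : 1 ≤ d) (hβ : 0 < β) (hb : 0 < b) (hab : b < a) {p : ℝ × ℝ}
    (hp : IsMinimizer d β a b 0 μ p) (hy : 0 < p.2) :
    muT d β a b ≤ μ ∧ p = pointTwo d β a b μ := by
  have ha := hb.trans hab
  have hs := hp.sBeta_eq_of_lt hd hβ hb hab (ENNReal.ofReal_pos.2 hy)
  have hx := hp.fst_pos hd hβ ha
  obtain ⟨hmem, hy2⟩ := mem_xTwoSolutions_of_eq hab hx (hp.sBeta_eq hd hβ ha) hs
  have hμ : muT d β a b ≤ μ := by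
    rw [← ((mem_xTwoSolutions_iff hb hab).1 hmem).2]
    exact muT_le_levelPotential hd hβ hb hab hx
  refine ⟨hμ, ?_⟩
  have hxc := (sBeta_neg_iff hd hβ hx).1 (by rw [hs]; exact neg_neg_of_pos (mul_pos hb hy))
  have hpeq : p = (p.1, (μ - a * p.1) / (a - b)) := Prod.ext rfl hy2
  rcases ((isLeast_xTwo hd hβ hb hab hμ).2 hmem).lt_or_eq with h | h
  · have h1 := energy_pointTwo_lt hd hβ hb hab hμ hmem h hxc.le
    rw [← hpeq] at h1
    have h2 := hp.2 _ (pointTwo_mem_stateSpace hd hβ hb hab hμ (zero_le (a := _)))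
    linarith
  · rw [hpeq, ← h]
    rfl

/-- Minimisers at `μ + ε / (n + 2)` have a limit point, which is a minimiser at `μ`. -/
lemma exists_limit_of_minimizers (hd : 1 ≤ d) (hβ : 0 < β) (hb : 0 < b) (hab : b < a)
    (ε : ℝ) :
    ∃ (q : ℝ × ℝ) (p : ℕ → ℝ × ℝ) (φ : ℕ → ℕ), IsMinimizer d β a b κ μ q ∧
      (∀ n, IsMinimizer d β a b κ (μ + ε * (1 / ((φ n : ℝ) + 2))) (p n)) ∧
      Tendsto p atTop (𝓝 q) := by
  choose p hp using fun ν => exists_isMinimizer (d := d) (μ := ν) (κ := κ) hd hβ hb hab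
  -- With `n + 2` the weights lie strictly below `1`, so for `ε ≠ 0` the potentials stay strictly
  -- between `μ` and `μ + ε`; the approach to `μ_r` from below needs this.
  have h2 : Tendsto (fun n : ℕ => 1 / ((n : ℝ) + 2)) atTop (𝓝 0) := by
    have := (tendsto_one_div_add_atTop_nhds_zero_nat (𝕜 := ℝ)).comp (tendsto_add_atTop_nat 1)
    refine this.congr fun n => ?_
    simp only [Function.comp]
    push_cast
    ring
  have hν : Tendsto (fun n : ℕ => μ + ε * (1 / ((n : ℝ) + 2))) atTop (𝓝 μ) := by
    simpa using (h2.const_mul ε).const_add μ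
  obtain ⟨q, φ, hq, -, hlim⟩ := exists_isMinimizer_of_tendsto hd hβ hb hab hν (fun n => hp _)
  exact ⟨q, _, φ, hq, fun n => hp _, hlim⟩

lemma muC_eq (hβ : 0 < β) (h3 : 3 ≤ d) : muC d β a = ((a * density d β 0 : ℝ) : EReal) := by
  rw [muC, criticalDensity_eq hβ h3, EReal.coe_mul]

lemma muC_eq_top (ha : 0 < a) (h3 : ¬3 ≤ d) : muC d β a = ⊤ := by
  unfold muC criticalDensity
  rw [if_neg h3]
  exact EReal.coe_mul_top_of_pos ha

lemma energy_swap (x t : ℝ) : energy d β a b μ (x - t, t) - energy d β a b μ (x, 0) =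
    freeEnergyReal d β (x - t) - freeEnergyReal d β x - b / 2 * t ^ 2 := by
  unfold energy interaction
  simp only
  ring

/-- At this `μ`, a minimiser with `y = 0` would have `x ≥ 2 p₀(0)/b + 1`. Condensing all of it costs
at most `p₀(0)` in free energy and gains `b x²/2`, which is more. -/
lemma exists_forall_minimizer_pos (hd : 1 ≤ d) (hβ : 0 < β) (hb : 0 < b) (hab : b < a) :
    ∃ μ, ∀ p, IsMinimizer d β a b 0 μ p → 0 < p.2 := by
  have ha := hb.trans hab
  have hP := pressureReal_nonneg (d := d) hβ 0
  refine ⟨a * (2 * pressureReal d β 0 / b + 1), fun p hp => ?_⟩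
  refine (nonneg_of_mem_stateSpace hp.1).2.lt_of_ne' fun h0 => ?_
  have hx := hp.fst_pos hd hβ ha
  have hs := hp.sBeta_eq hd hβ ha
  have hs0 := sBeta_nonpos hd hβ hx
  have hxle : 2 * pressureReal d β 0 / b + 1 ≤ p.1 := by
    refine le_of_mul_le_mul_left ?_ ha
    rw [h0] at hs
    linarith
  have h1 := hp.2 (p.1 - p.1, p.1) (mem_stateSpace_of_le (by simp) hx.le (zero_le (a := _)))
  have h2 := energy_swap (d := d) (β := β) (a := a) (b := b)
    (μ := a * (2 * pressureReal d β 0 / b + 1)) p.1 p.1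
  have hpeq : p = (p.1, (0 : ℝ)) := Prod.ext rfl h0
  rw [hpeq] at h1
  simp only at h1
  have h3 := neg_pressureReal_le hd hβ hx.le
  have h4 := freeEnergyReal_nonpos hd hβ (sub_self p.1).ge
  have h6 : 0 ≤ 2 * pressureReal d β 0 / b := by positivity
  have h7 : b * (2 * pressureReal d β 0 / b) = 2 * pressureReal d β 0 := by field_simp
  have h8 : b * (2 * pressureReal d β 0 / b + 1) ≤ b * p.1 := by gcongr
  have h9 : b * p.1 * 1 ≤ b * p.1 * p.1 := by gcongr; linarith
  nlinarith

/-- The phase transition without a constraint on the condensate. -/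
lemma exists_transition (hd : 1 ≤ d) (hβ : 0 < β) (hb : 0 < b) (hab : b < a) :
    ∃ μs : ℝ, muT d β a b ≤ μs ∧ (μs : EReal) ≤ muC d β a ∧
      (∀ μ < μs, zeroSet d β a b 0 μ = {pointOne d β a μ}) ∧
      zeroSet d β a b 0 μs = {pointOne d β a μs, pointTwo d β a b μs} ∧
      (∀ μ > μs, zeroSet d β a b 0 μ = {pointTwo d β a b μ}) ∧
      ((μs : EReal) = muC d β a → pointOne d β a μs = pointTwo d β a b μs) := by
  have ha := hb.trans hab
  have hlow : ∀ μ < muT d β a b, ∀ p, IsMinimizer d β a b 0 μ p → p = pointOne d β a μ := by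
    intro μ hμ p hp
    refine hp.eq_pointOne hd hβ ha ?_
    refine (nonneg_of_mem_stateSpace hp.1).2.eq_or_lt.elim Eq.symm fun h => ?_
    exact absurd (hp.eq_pointTwo hd hβ hb hab h).1 (not_le.2 hμ)
  have hone : ∀ μ < muT d β a b, IsMinimizer d β a b 0 μ (pointOne d β a μ) := by
    intro μ hμ
    obtain ⟨p, hp⟩ := exists_isMinimizer (d := d) (μ := μ) (κ := 0) hd hβ hb hab
    exact hlow μ hμ p hp ▸ hp
  obtain ⟨μs, h1, h2, h3⟩ := exists_threshold (κ := 0) hd hβ hb hab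
    ⟨_, hone (muT d β a b - 1) (by linarith)⟩ (exists_forall_minimizer_pos hd hβ hb hab)
  have hμT : muT d β a b ≤ μs := by
    by_contra! h
    obtain ⟨μ, hμs, hμ⟩ := exists_between h
    exact absurd (h3 μ hμs _ (hone μ hμ)) (lt_irrefl _)
  have hμC : (μs : EReal) ≤ muC d β a := by
    by_cases hd3 : 3 ≤ d
    · rw [muC_eq hβ hd3, EReal.coe_le_coe_iff]
      by_contra! hlt
      obtain ⟨hx, hs⟩ := xOne_spec (d := d) hd hβ ha μs
      have hρ : 0 < density d β 0 := (density_pos hβ (by norm_num : (-1 : ℝ) < 0)).trans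
        (density_lt_density hβ (by norm_num) (Or.inr ⟨rfl, hd3⟩))
      have hs0 := sBeta_nonpos hd hβ hx
      have hρx : density d β 0 < xOne d β a μs := by nlinarith
      -- Moving the excess `x - ϱ_c` into the condensate does not raise the free energy, which has
      -- slope `0` at `ϱ_c`, and lowers the interaction by `b/2 (x - ϱ_c)²`.
      have h4 := (h1 μs le_rfl).2
        (xOne d β a μs - (xOne d β a μs - density d β 0), xOne d β a μs - density d β 0)
        (mem_stateSpace_of_le (by linarith) (by linarith) (zero_le (a := _)))
      have h5 := energy_swap (d := d) (β := β) (a := a) (b := b) (μ := μs) (xOne d β a μs)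
        (xOne d β a μs - density d β 0)
      have h6 := freeEnergyReal_subgradient hd hβ hρ hx.le
      rw [sBeta_eq_zero (criticalDensity_eq hβ hd3).le] at h6
      rw [sub_sub_cancel] at h4 h5
      have h7 : 0 < b / 2 * (xOne d β a μs - density d β 0) ^ 2 := by
        have : 0 < xOne d β a μs - density d β 0 := by linarith
        positivity
      unfold pointOne at h4
      linarith
    · rw [muC_eq_top ha hd3]
      exact le_top
  have hlt : ∀ μ < μs, zeroSet d β a b 0 μ = {pointOne d β a μ} := fun μ hμ =>
    zeroSet_eq_singleton hd hβ hb hab fun p hp => hp.eq_pointOne hd hβ ha (h2 μ hμ p hp)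
  have hgt : ∀ μ > μs, zeroSet d β a b 0 μ = {pointTwo d β a b μ} := fun μ hμ =>
    zeroSet_eq_singleton hd hβ hb hab fun p hp => (hp.eq_pointTwo hd hβ hb hab (h3 μ hμ p hp)).2
  have htwo : IsMinimizer d β a b 0 μs (pointTwo d β a b μs) := by
    obtain ⟨q, p, φ, hq, hp, hlim⟩ :=
      exists_limit_of_minimizers (κ := 0) (μ := μs) hd hβ hb hab 1
    have hpos : ∀ n, 0 < (p n).2 := fun n => h3 _ (by
      have : (0 : ℝ) < 1 / ((φ n : ℝ) + 2) := by positivity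
      linarith) _ (hp n)
    rcases (nonneg_of_mem_stateSpace hq.1).2.lt_or_eq with hq0 | hq0
    · exact (hq.eq_pointTwo hd hβ hb hab hq0).2 ▸ hq
    -- The condensate may vanish in the limit. Still `s_β(x) = -b y` and `x ≤ ϱ_c` pass to the
    -- limit, so the trapezoid comparison identifies it with `pointTwo`.
    · have hx := hq.fst_pos hd hβ ha
      have hsn : ∀ n, sBeta d β (p n).1 = -(b * (p n).2) := fun n =>
        (hp n).sBeta_eq_of_lt hd hβ hb hab (ENNReal.ofReal_pos.2 (hpos n))
      have hl1 : Tendsto (fun n => (p n).1) atTop (𝓝 q.1) := (continuous_fst.tendsto q).comp hlim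
      have hl2 : Tendsto (fun n => (p n).2) atTop (𝓝 q.2) := (continuous_snd.tendsto q).comp hlim
      have hs : sBeta d β q.1 = -(b * q.2) := by
        refine tendsto_nhds_unique ((continuousAt_sBeta hd hβ hx).tendsto.comp hl1) ?_
        exact ((hl2.const_mul b).neg).congr fun n => (hsn n).symm
      have hxc : (q.1 : EReal) ≤ criticalDensity d β := by
        refine le_of_tendsto ((continuous_coe_real_ereal.tendsto q.1).comp hl1)
          (Eventually.of_forall fun n => ?_)
        refine ((sBeta_neg_iff hd hβ ((hp n).fst_pos hd hβ ha)).1 ?_).le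
        rw [hsn n]
        exact neg_neg_of_pos (mul_pos hb (hpos n))
      obtain ⟨hmem, hy⟩ := mem_xTwoSolutions_of_eq hab hx (hq.sBeta_eq hd hβ ha) hs
      have hqeq : q = (q.1, (μs - a * q.1) / (a - b)) := Prod.ext rfl hy
      rcases ((isLeast_xTwo hd hβ hb hab hμT).2 hmem).lt_or_eq with h | h
      · have h4 := energy_pointTwo_lt hd hβ hb hab hμT hmem h hxc
        rw [← hqeq] at h4
        have h5 := hq.2 _ (pointTwo_mem_stateSpace hd hβ hb hab hμT (zero_le (a := _)))
        linarith
      · rw [← h] at hqeq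
        exact (show q = pointTwo d β a b μs from hqeq) ▸ hq
  refine ⟨μs, hμT, hμC, hlt, ?_, hgt, ?_⟩
  · refine zeroSet_eq_pair hd hβ hb hab (fun p hp => ?_) (h1 μs le_rfl) htwo
    rcases (nonneg_of_mem_stateSpace hp.1).2.lt_or_eq with hp0 | hp0
    · exact Or.inr (hp.eq_pointTwo hd hβ hb hab hp0).2
    · exact Or.inl (hp.eq_pointOne hd hβ ha hp0.symm)
  · intro he
    have hd3 : 3 ≤ d := by
      by_contra h
      rw [muC_eq_top ha h] at he
      exact EReal.coe_ne_top _ he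
    rw [muC_eq hβ hd3] at he
    replace he : μs = a * density d β 0 := EReal.coe_injective he
    have hcrit := criticalDensity_eq (d := d) hβ hd3
    have hρ : 0 < density d β 0 := (density_pos hβ (by norm_num : (-1 : ℝ) < 0)).trans
      (density_lt_density hβ (by norm_num) (Or.inr ⟨rfl, hd3⟩))
    -- At `μ_c` the point `(ϱ_c, 0)` satisfies both stationarity equations. A smaller solution would
    -- have strictly less energy, contradicting minimality of `pointOne`.
    have hs := sBeta_eq_zero (d := d) hcrit.le
    have hx1 : density d β 0 = xOne d β a μs := eq_xOne hd hβ ha hρ (by rw [hs, he, sub_self])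
    obtain ⟨hmem, hy⟩ := mem_xTwoSolutions_of_eq (μ := μs) (y := 0) hab hρ
      (by rw [hs, he]; ring) (by rw [hs]; ring)
    have hpt : pointOne d β a μs = (density d β 0, (μs - a * density d β 0) / (a - b)) := by
      rw [← hy, hx1]
      rfl
    rcases ((isLeast_xTwo hd hβ hb hab hμT).2 hmem).lt_or_eq with h | h
    · have h4 := energy_pointTwo_lt hd hβ hb hab hμT hmem h hcrit.ge
      rw [← hpt] at h4
      have h5 := (h1 μs le_rfl).2 _ htwo.1
      linarith
    · rw [hpt, ← h]
      rfl

/-- A condensate above `κ` would be stationary in `y` as well, hence put `μ` into `muRSet`; below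
`μ_r` the constraint must bind. -/
lemma IsMinimizer.eq_pointThree (hd : 1 ≤ d) (hβ : 0 < β) (hb : 0 < b) (hab : b < a) {κ : ℝ}
    (hκ : 0 < κ) {p : ℝ × ℝ} (hp : IsMinimizer d β a b (ENNReal.ofReal κ) μ p) (hy : 0 < p.2)
    (hμ : μ < muR d β a b κ) : p = pointThree d β a κ μ := by
  have ha := hb.trans hab
  have hle : κ ≤ p.2 := (ENNReal.ofReal_le_ofReal_iff hy.le).1 (le_of_mem_stateSpace hp.1 hy)
  have hyκ : p.2 = κ := by
    refine hle.eq_or_lt.elim Eq.symm fun hlt => absurd hμ (not_lt.2 ?_)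
    have hs := hp.sBeta_eq_of_lt hd hβ hb hab ((ENNReal.ofReal_lt_ofReal_iff hy).2 hlt)
    have hx := hp.fst_pos hd hβ ha
    have hmem := (mem_xTwoSolutions_of_eq hab hx (hp.sBeta_eq hd hβ ha) hs).1
    rw [← mem_Ici, ← muRSet_eq hd hβ hb hab hκ, mem_muRSet_iff_exists hd hβ hb hab]
    refine ⟨p.1, hx, ?_, ((mem_xTwoSolutions_iff hb hab).1 hmem).2⟩
    rw [hs]
    nlinarith
  have h1 := hp.fst_eq hd hβ ha
  rw [hyκ] at h1
  exact Prod.ext h1 hyκ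

lemma zeroSet_eq_of_muR_le (hd : 1 ≤ d) (hβ : 0 < β) (hb : 0 < b) (hab : b < a) {κ : ℝ}
    (hκ : 0 < κ) (hμ : muR d β a b κ ≤ μ)
    (hzero : pointTwo d β a b μ ∈ zeroSet d β a b 0 μ) :
    pointTwo d β a b μ ∈ stateSpace (ENNReal.ofReal κ) ∧ 0 < (pointTwo d β a b μ).2 ∧
      zeroSet d β a b (ENNReal.ofReal κ) μ =
        zeroSet d β a b 0 μ ∩ stateSpace (ENNReal.ofReal κ) := by
  have hmem : μ ∈ muRSet d β a b κ := by rwa [muRSet_eq hd hβ hb hab hκ]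
  obtain ⟨h1, h2⟩ := (mem_muRSet_iff hb hab).1 hmem
  have h3 := pointTwo_mem_stateSpace hd hβ hb hab h1
    (ENNReal.ofReal_le_ofReal (show κ ≤ (pointTwo d β a b μ).2 from h2))
  exact ⟨h3, hκ.trans_le h2, zeroSet_eq_inter hd hβ hb hab hzero h3⟩

/-- The phase transition when the condensate is bounded below by `κ` and `μ_r(κ) > μ*`. -/
lemma exists_transition_of_lt_muR (hd : 1 ≤ d) (hβ : 0 < β) (hb : 0 < b) (hab : b < a) {κ : ℝ}
    (hκ : 0 < κ) {μs : ℝ} (hT : muT d β a b ≤ μs) (hR : μs < muR d β a b κ)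
    (heq : zeroSet d β a b 0 μs = {pointOne d β a μs, pointTwo d β a b μs})
    (hgt : ∀ μ > μs, zeroSet d β a b 0 μ = {pointTwo d β a b μ}) :
    ∃ μκ, μs < μκ ∧ μκ < muR d β a b κ ∧
      (∀ μ < μκ, zeroSet d β a b (ENNReal.ofReal κ) μ = {pointOne d β a μ}) ∧
      zeroSet d β a b (ENNReal.ofReal κ) μκ = {pointOne d β a μκ, pointThree d β a κ μκ} ∧
      (∀ μ, μκ < μ → μ ≤ muR d β a b κ →
        zeroSet d β a b (ENNReal.ofReal κ) μ = {pointThree d β a κ μ}) ∧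
      (∀ μ, muR d β a b κ ≤ μ →
        zeroSet d β a b (ENNReal.ofReal κ) μ = {pointTwo d β a b μ}) := by
  have ha := hb.trans hab
  have hge : ∀ μ, muR d β a b κ ≤ μ → 0 < (pointTwo d β a b μ).2 ∧
      zeroSet d β a b (ENNReal.ofReal κ) μ = {pointTwo d β a b μ} := by
    intro μ hμ
    have hz := hgt μ (hR.trans_le hμ)
    obtain ⟨h1, h2, h3⟩ := zeroSet_eq_of_muR_le hd hβ hb hab hκ hμ (by rw [hz]; rfl)
    rw [hz, inter_eq_left.2 (singleton_subset_iff.2 h1)] at h3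
    exact ⟨h2, h3⟩
  have hμs : zeroSet d β a b (ENNReal.ofReal κ) μs =
      zeroSet d β a b 0 μs ∩ stateSpace (ENNReal.ofReal κ) :=
    zeroSet_eq_inter hd hβ hb hab (p := pointOne d β a μs) (by rw [heq]; simp)
      (pointOne_mem_stateSpace hd hβ ha)
  have hμs1 : IsMinimizer d β a b (ENNReal.ofReal κ) μs (pointOne d β a μs) := by
    rw [← mem_zeroSet hd hβ hb hab, hμs, heq]
    exact ⟨by simp, pointOne_mem_stateSpace hd hβ ha⟩
  -- At `μ*` the only condensed candidate is `pointTwo`, whose condensate is below `κ` because `μ* <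
  -- μ_r`. So the transition is delayed past `μ*`.
  have hμs0 : ∀ p, IsMinimizer d β a b (ENNReal.ofReal κ) μs p → ¬0 < p.2 := by
    intro p hp hy
    have hle := le_of_mem_stateSpace hp.1 hy
    rw [← mem_zeroSet hd hβ hb hab, hμs, heq] at hp
    rcases hp.1 with rfl | rfl
    · exact lt_irrefl _ hy
    · have hmem : μs ∈ muRSet d β a b κ :=
        (mem_muRSet_iff hb hab).2 ⟨hT, (ENNReal.ofReal_le_ofReal_iff hy.le).1 hle⟩
      rw [muRSet_eq hd hβ hb hab hκ] at hmem
      exact absurd hR (not_lt.2 hmem)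
  obtain ⟨μκ, h1, h2, h3⟩ := exists_threshold (κ := ENNReal.ofReal κ) hd hβ hb hab
    ⟨μs, hμs1⟩ ⟨muR d β a b κ, fun p hp => by
      obtain ⟨h1, h2⟩ := hge _ le_rfl
      rw [← mem_zeroSet hd hβ hb hab, h2] at hp
      rwa [hp]⟩
  have hκR : μκ < muR d β a b κ := by
    by_contra! h
    obtain ⟨h4, h5⟩ := hge _ le_rfl
    have h6 := h1 _ h
    rw [← mem_zeroSet hd hβ hb hab, h5, mem_singleton_iff] at h6
    rw [← h6] at h4
    exact lt_irrefl _ h4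
  have hthree : IsMinimizer d β a b (ENNReal.ofReal κ) μκ (pointThree d β a κ μκ) := by
    obtain ⟨q, p, φ, hq, hp, hlim⟩ :=
      exists_limit_of_minimizers (κ := ENNReal.ofReal κ) (μ := μκ) hd hβ hb hab 1
    have hpos : ∀ n, 0 < (p n).2 := fun n => h3 _ (by
      have : (0 : ℝ) < 1 / ((φ n : ℝ) + 2) := by positivity
      linarith) _ (hp n)
    have hqκ : κ ≤ q.2 := ge_of_tendsto ((continuous_snd.tendsto q).comp hlim)
      (Eventually.of_forall fun n => (ENNReal.ofReal_le_ofReal_iff (hpos n).le).1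
        (le_of_mem_stateSpace (hp n).1 (hpos n)))
    exact hq.eq_pointThree hd hβ hb hab hκ (hκ.trans_le hqκ) hκR ▸ hq
  have hsκ : μs < μκ := by
    by_contra! h
    rcases h.lt_or_eq with h | h
    · exact hμs0 _ hμs1 (h3 μs h _ hμs1)
    · exact hμs0 _ (h ▸ hthree) hκ
  refine ⟨μκ, hsκ, hκR, fun μ hμ => zeroSet_eq_singleton hd hβ hb hab fun p hp =>
    hp.eq_pointOne hd hβ ha (h2 μ hμ p hp), ?_, ?_, fun μ hμ => (hge μ hμ).2⟩
  · refine zeroSet_eq_pair hd hβ hb hab (fun p hp => ?_) (h1 μκ le_rfl) hthree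
    rcases (nonneg_of_mem_stateSpace hp.1).2.lt_or_eq with hp0 | hp0
    · exact Or.inr (hp.eq_pointThree hd hβ hb hab hκ hp0 hκR)
    · exact Or.inl (hp.eq_pointOne hd hβ ha hp0.symm)
  · intro μ hμ hμR
    rcases hμR.lt_or_eq with hlt | rfl
    · exact zeroSet_eq_singleton hd hβ hb hab fun p hp =>
        hp.eq_pointThree hd hβ hb hab hκ (h3 μ hμ p hp) hlt
    -- At `μ_r` itself, the limit of minimisers from below is `pointThree`, while the unique
    -- minimiser is `pointTwo`; the two descriptions coincide.
    · obtain ⟨q, p, φ, hq, hp, hlim⟩ := exists_limit_of_minimizers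
        (κ := ENNReal.ofReal κ) (μ := muR d β a b κ) hd hβ hb hab
        (μκ - muR d β a b κ)
      have hpn : ∀ n, (p n).2 = κ := fun n => by
        have hn0 : (0 : ℝ) < 1 / ((φ n : ℝ) + 2) := by positivity
        have hn1 : 1 / ((φ n : ℝ) + 2) < 1 := by
          rw [div_lt_one (by positivity)]
          linarith [(Nat.cast_nonneg (φ n) : (0 : ℝ) ≤ φ n)]
        rw [(hp n).eq_pointThree hd hβ hb hab hκ (h3 _ (by nlinarith) _ (hp n)) (by nlinarith)]
        rfl
      have hqκ : q.2 = κ := tendsto_nhds_unique ((continuous_snd.tendsto q).comp hlim)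
        (tendsto_const_nhds.congr fun n => (hpn n).symm)
      have hqx := hq.fst_eq hd hβ ha
      rw [hqκ] at hqx
      have hq3 : q = pointThree d β a κ (muR d β a b κ) := Prod.ext hqx hqκ
      have hq2 := hq
      rw [← mem_zeroSet hd hβ hb hab, (hge _ le_rfl).2, mem_singleton_iff] at hq2
      rw [(hge _ le_rfl).2, ← hq2, hq3]

end ZeroSets

end HYL

end

theorem mainTheorem2 (d : ℕ) (hd : 1 ≤ d) (β a b : ℝ) (hβ : 0 < β) (hb : 0 < b) (hab : b < a) :
    -- the functions and numbers in the statement are well defined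
    ((∀ x : ℝ, 0 < x → (x : EReal) < HYL.criticalDensity d β →
        ∃! s : ℝ, s < 0 ∧ HYL.idealPressureDeriv d β s = x) ∧
      (∀ μ : ℝ, ∃! x : ℝ, 0 < x ∧ HYL.sBeta d β x = μ - a * x) ∧
      (∀ μ : ℝ, HYL.muT d β a b ≤ μ →
        IsLeast (HYL.xTwoSolutions d β a b μ) (HYL.xTwo d β a b μ)) ∧
      (∀ κ : ℝ, 0 < κ → (HYL.muRSet d β a b κ).Nonempty)) ∧
    (∃ μs : ℝ, HYL.muT d β a b ≤ μs ∧ (μs : EReal) ≤ HYL.muC d β a ∧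
      -- the case `κ = 0`
      (∀ μ : ℝ, μ < μs → HYL.zeroSet d β a b 0 μ = {HYL.pointOne d β a μ}) ∧
      HYL.zeroSet d β a b 0 μs = {HYL.pointOne d β a μs, HYL.pointTwo d β a b μs} ∧
      (∀ μ : ℝ, μs < μ → HYL.zeroSet d β a b 0 μ = {HYL.pointTwo d β a b μ}) ∧
      ((μs : EReal) = HYL.muC d β a →
        HYL.xOne d β a μs = HYL.xTwo d β a b μs ∧
        (∀ μ : ℝ, (μ : EReal) ≤ HYL.muC d β a →
          HYL.zeroSet d β a b 0 μ = {HYL.pointOne d β a μ}) ∧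
        (∀ μ : ℝ, HYL.muC d β a < (μ : EReal) →
          HYL.zeroSet d β a b 0 μ = {HYL.pointTwo d β a b μ})) ∧
      -- the case `0 < κ < ∞`
      (∀ κ : ℝ, 0 < κ → ∃ μκ : ℝ,
        (HYL.muR d β a b κ ≤ μs →
          μκ = μs ∧
          (∀ μ : ℝ, μ < μκ →
            HYL.zeroSet d β a b (ENNReal.ofReal κ) μ = {HYL.pointOne d β a μ}) ∧
          HYL.zeroSet d β a b (ENNReal.ofReal κ) μκ =
            {HYL.pointOne d β a μκ, HYL.pointTwo d β a b μκ} ∧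
          (∀ μ : ℝ, μκ < μ →
            HYL.zeroSet d β a b (ENNReal.ofReal κ) μ = {HYL.pointTwo d β a b μ})) ∧
        (μs < HYL.muR d β a b κ →
          μs < μκ ∧ μκ < HYL.muR d β a b κ ∧
          (∀ μ : ℝ, μ < μκ →
            HYL.zeroSet d β a b (ENNReal.ofReal κ) μ = {HYL.pointOne d β a μ}) ∧
          HYL.zeroSet d β a b (ENNReal.ofReal κ) μκ =
            {HYL.pointOne d β a μκ, HYL.pointThree d β a κ μκ} ∧
          (∀ μ : ℝ, μκ < μ → μ ≤ HYL.muR d β a b κ →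
            HYL.zeroSet d β a b (ENNReal.ofReal κ) μ = {HYL.pointThree d β a κ μ}) ∧
          (∀ μ : ℝ, HYL.muR d β a b κ ≤ μ →
            HYL.zeroSet d β a b (ENNReal.ofReal κ) μ = {HYL.pointTwo d β a b μ})))) ∧
    -- the case `κ = ∞`
    (∀ μ : ℝ, HYL.zeroSet d β a b ⊤ μ = {HYL.pointOne d β a μ}) := by
  have ha := hb.trans hab
  obtain ⟨μs, hT, hC, hlt, heq, hgt, hmuC⟩ := HYL.exists_transition (d := d) hd hβ hb hab
  refine ⟨⟨fun x hx hxc => HYL.existsUnique_idealPressureDeriv_eq hd hβ hx hxc,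
    HYL.existsUnique_xOne hd hβ ha, fun μ hμ => HYL.isLeast_xTwo hd hβ hb hab hμ,
    fun κ hκ => ⟨_, (HYL.muRSet_eq (d := d) hd hβ hb hab hκ).symm ▸ Set.self_mem_Ici⟩⟩,
    ⟨μs, hT, hC, hlt, heq, hgt, fun he => ?_, fun κ hκ => ?_⟩,
    fun μ => HYL.zeroSet_top hd hβ hb hab⟩
  · have hpt := hmuC he
    refine ⟨congrArg Prod.fst hpt, fun μ hμ => ?_, fun μ hμ => ?_⟩
    · rw [← he, EReal.coe_le_coe_iff] at hμ
      rcases hμ.lt_or_eq with h | rfl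
      · exact hlt μ h
      · rw [heq, ← hpt, Set.pair_eq_singleton]
    · rw [← he, EReal.coe_lt_coe_iff] at hμ
      exact hgt μ hμ
  · rcases le_or_gt (HYL.muR d β a b κ) μs with hR | hR
    · refine ⟨μs, fun _ => ⟨rfl, fun μ hμ => ?_, ?_, fun μ hμ => ?_⟩,
        fun h => absurd hR (not_le.2 h)⟩
      · have hmem := HYL.pointOne_mem_stateSpace (d := d) (κ := ENNReal.ofReal κ) (μ := μ) hd hβ ha
        rw [HYL.zeroSet_eq_inter hd hβ hb hab (p := HYL.pointOne d β a μ)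
          (by rw [hlt μ hμ]; rfl) hmem, hlt μ hμ]
        exact Set.inter_eq_left.2 (Set.singleton_subset_iff.2 hmem)
      · obtain ⟨h1, -, h2⟩ := HYL.zeroSet_eq_of_muR_le hd hβ hb hab hκ hR (by rw [heq]; simp)
        rw [h2, heq]
        exact Set.inter_eq_left.2
          (Set.pair_subset (HYL.pointOne_mem_stateSpace hd hβ ha) h1)
      · obtain ⟨h1, -, h2⟩ := HYL.zeroSet_eq_of_muR_le hd hβ hb hab hκ (hR.trans hμ.le)
          (by rw [hgt μ hμ]; rfl)
        rw [h2, hgt μ hμ]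
        exact Set.inter_eq_left.2 (Set.singleton_subset_iff.2 h1)
    · obtain ⟨μκ, h⟩ := HYL.exists_transition_of_lt_muR hd hβ hb hab hκ hT hR heq hgt
      exact ⟨μκ, fun h' => absurd hR (not_lt.2 h'), fun _ => h⟩
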